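/- **Setting.** Let $1/2<\alpha\le 1$, $\sigma_p>0$, $\gamma<1/6$ and $K\in\mathbb N$ be constants. A data point $(x,y,a)\in(\mathbb R^d)^3\times\{\pm1\}\times\{\pm1\}$ is generated as follows: the true label $y$ is random with an arbitrary law; independently of $y$, the spurious label $a$ equals $y$ with probability $\alpha$ and $-y$ otherwise; $x$ consists of the three patches $\beta_c\,y\,v_c$, $\beta_s\,a\,v_s$ and $\xi$, in an order drawn at random from an arbitrary law, where $\|v_c\|_2=\|v_s\|_2=1$, $\langle v_c,v_s\rangle=0$, $\beta_c,\beta_s>0$, and $\xi\sim N(0,(\sigma_p^2/d)I_d)$; the true label, the event $a=y$, the order and the noise are independent. The training set $(x_i,y_i,a_i)_{i=1}^N$ is i.i.d. and $\hat\alpha$ is the proportion of indices $i$ with $a_i=y_i$. The two-layer CNN is $f(x;W)=\sum_{j=1}^J\sum_{p=1}^3\langle w_j,x^{(p)}\rangle^3$, the empirical loss is $\mathcal L(W)=\frac1N\sum_{i=1}^N\log\bigl(1+e^{-y_if(x_i;W)}\bigr)$, and gradient descent is $W^{(t+1)}=W^{(t)}-\eta\nabla\mathcal L(W^{(t)})$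 with $0<\eta\le 1$. It starts from independent $w_j^{(0)}\sim N(0,\sigma_0^2I_d)$, independent of the data, with $(\log d)^{-K}/d\le\sigma_0^2\le(\log d)^{K}/d$. **Theorem 1.** There are $k,m\in\mathbb N$ and $c>0$, depending only on $\alpha,\sigma_p,\gamma,K$, such that for every $\delta>0$ there are $d_0,J_0$ with the following property. Suppose $d\ge d_0$, $J_0\le J\le(\log d)^K$, $(\log d)^m\le N\le d^K$, $(\log d)^{-K}\le\beta_s\le(\log d)^K$ and $d^{-\gamma}\le\beta_c\le c\,\beta_s$, and write $L=(\log d)^k$. Then, with probability at least $1-\delta$ over the training set and the initialization, $\hat\alpha>1/2$ and there is a (trajectory-dependent) $T_0\in\mathbb N$ with $$L^{-1}\frac{1}{\eta\beta_s^3\sigma_0}\le T_0\le L\,\frac{1}{\eta\beta_s^3\sigma_0}\qquad\Bigl(T_0=\tilde\Theta\bigl(1/(\eta\beta_s^3\sigma_0)\bigr)\Bigr)$$ such that for all $j\in[J]$ and all integers $t\in[0,T_0)$ $$L^{-1}\eta\,\beta_s^3(2\hat\alpha-1)\langle w_j^{(t)},v_s\rangle^2\le\langle w_j^{(t+1)},v_s\rangle-\langle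 w_j^{(t)},v_s\rangle\le L\,\eta\,\beta_s^3\hat\alpha\langle w_j^{(t)},v_s\rangle^2,$$ $$L^{-1}\eta\,\beta_c^3\hat\alpha\langle w_j^{(t)},v_c\rangle^2\le\langle w_j^{(t+1)},v_c\rangle-\langle w_j^{(t)},v_c\rangle\le L\,\eta\,\beta_c^3\langle w_j^{(t)},v_c\rangle^2,$$ and after $T_0$ steps the network has learned the spurious feature and not the core feature: $$\max_{j\in[J]}\langle w_j^{(T_0)},v_s\rangle\ge L^{-1}\frac1{\beta_s}=\tilde\Omega(1/\beta_s),\qquad \Bigl|\max_{j\in[J]}\langle w_j^{(T_0)},v_c\rangle\Bigr|\le L\,\sigma_0=\tilde O(\sigma_0).$$ -/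

import Mathlib

open MeasureTheory ProbabilityTheory

noncomputable section

namespace SpuriousCNN

/-- The input space `ℝ^d` of a patch, with its Euclidean norm. -/
abbrev Patch (d : ℕ) : Type := EuclideanSpace ℝ (Fin d)

/-- A data point `(x, y, a)`: three patches, the true label and the spurious label. -/
structure DataPoint (d : ℕ) where
  x : Fin 3 → Patch d
  y : ℝ
  a : ℝ

/-- The law on `{1, -1}` that gives mass `q` to `1` and `1 - q` to `-1`. -/
def signLaw (q : ℝ) : Measure ℝ :=
  ENNReal.ofReal q • Measure.dirac 1 + ENNReal.ofReal (1 - q) • Measure.dirac (-1)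

/-- The centred Gaussian `N(0, s² I_d)` on `ℝ^d`. -/
def isoGaussian (d : ℕ) (s : ℝ) : Measure (Patch d) :=
  (stdGaussian (Patch d)).map (fun z => s • z)

/-- Orders of the three patches carry the discrete σ-algebra. -/
instance : MeasurableSpace (Equiv.Perm (Fin 3)) := ⊤

/-- The parameters of the data distribution in dimension `d`, apart from the probability `α`
that the spurious label equals the true label and the noise level `σp`. -/
structure DataModel (d : ℕ) where
  /-- core feature direction -/
  vc : Patch d
  /-- spurious feature direction -/
  vs : Patch d
  norm_vc : ‖vc‖ = 1
  norm_vs : ‖vs‖ = 1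
  inner_vc_vs : inner ℝ vc vs = 0
  /-- core feature strength -/
  βc : ℝ
  /-- spurious feature strength -/
  βs : ℝ
  βc_pos : 0 < βc
  βs_pos : 0 < βs
  /-- probability that the true label is `1` -/
  q : ℝ
  q_nonneg : 0 ≤ q
  q_le_one : q ≤ 1
  /-- law of the order in which the patches appear -/
  order : Measure (Equiv.Perm (Fin 3))
  order_prob : IsProbabilityMeasure order

/-- The independent random choices from which one data point is built: the true label `y`, the
sign `b = a * y`, the order of the patches and the noise patch. -/
abbrev Seed (d : ℕ) : Type := ℝ × ℝ × Equiv.Perm (Fin 3) × Patch d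

namespace DataModel

variable {d : ℕ}

/-- The law of the random choices for one data point; the noise is `N(0, (σp² / d) I_d)`. -/
def seedLaw (D : DataModel d) (α σp : ℝ) : Measure (Seed d) :=
  (signLaw D.q).prod ((signLaw α).prod (D.order.prod (isoGaussian d (σp / √d))))

/-- The data point built from the random choices `z = (y, b, π, ξ)`: the spurious label is
`a = b * y`, and the patches `βc y vc`, `βs a vs`, `ξ` appear in the order given by `π`. -/
def dataPoint (D : DataModel d) (z : Seed d) : DataPoint d where
  x := fun p => ![(D.βc * z.1) • D.vc, (D.βs * (z.2.1 * z.1)) • D.vs, z.2.2.2] (z.2.2.1 p)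
  y := z.1
  a := z.2.1 * z.1

/-- The joint law of the choices for `N` independent data points and of `J` initial weight
vectors, independent of each other and of the data, with law `N(0, σ0² I_d)`. -/
def jointLaw (D : DataModel d) (α σp σ0 : ℝ) (N J : ℕ) :
    Measure ((Fin N → Seed d) × (Fin J → Patch d)) :=
  (Measure.pi fun _ => D.seedLaw α σp).prod (Measure.pi fun _ => isoGaussian d σ0)

/-- The training set built from the choices for `N` data points. -/
def dataset (D : DataModel d) {N : ℕ} (z : Fin N → Seed d) : Fin N → DataPoint d :=
  fun i => D.dataPoint (z i)

end DataModel

/-- Weight matrices `W = [w_1, …, w_J]`, with the Euclidean (Frobenius) inner product. -/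
abbrev Weights (J d : ℕ) : Type := PiLp 2 (fun _ : Fin J => Patch d)

/-- The two-layer CNN with cubic activation. -/
def cnn {J d : ℕ} (W : Weights J d) (x : Fin 3 → Patch d) : ℝ :=
  ∑ j, ∑ p, (inner ℝ (W j) (x p)) ^ 3

/-- The logistic loss. -/
def logisticLoss (z : ℝ) : ℝ := Real.log (1 + Real.exp (-z))

/-- The empirical loss over a training set. -/
def empiricalLoss {N J d : ℕ} (S : Fin N → DataPoint d) (W : Weights J d) : ℝ :=
  (1 / (N : ℝ)) * ∑ i, logisticLoss ((S i).y * cnn W (S i).x)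

/-- Gradient descent on the empirical loss with learning rate `η`, started at `W0`. -/
def gd {N J d : ℕ} (S : Fin N → DataPoint d) (η : ℝ) (W0 : Weights J d) : ℕ → Weights J d
  | 0 => W0
  | t + 1 => gd S η W0 t - η • gradient (empiricalLoss S) (gd S η W0 t)

open scoped Classical in
/-- The proportion `α̂` of the training data whose spurious label equals the true label. -/
def groupProportion {N d : ℕ} (S : Fin N → DataPoint d) : ℝ :=
  ((Finset.univ.filter fun i => (S i).a = (S i).y).card : ℝ) / N

/-- The iterate `w_j^{(t)}` of gradient descent for the random choices `ω`. -/
def DataModel.neuron {N J d : ℕ} (D : DataModel d) (η : ℝ)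
    (ω : (Fin N → Seed d) × (Fin J → Patch d)) (t : ℕ) (j : Fin J) : Patch d :=
  gd (D.dataset ω.1) η (WithLp.toLp 2 ω.2) t j

/-- What gradient descent does for the random choices `ω`, with `L` the size of the factors that
the `Θ̃`, `Ω̃` and `Õ` notations hide: up to a time `T₀` of order `1 / (η βs³ σ0)` every neuron
obeys the growth bounds, and at time `T₀` the spurious feature is learned, the core feature not. -/
def DataModel.LearnsSpurious {N J d : ℕ} (D : DataModel d) (η σ0 L : ℝ)
    (ω : (Fin N → Seed d) × (Fin J → Patch d)) : Prop :=
  1 / 2 < groupProportion (D.dataset ω.1) ∧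
  ∃ T₀ : ℕ,
    L⁻¹ * (1 / (η * D.βs ^ 3 * σ0)) ≤ T₀ ∧ T₀ ≤ L * (1 / (η * D.βs ^ 3 * σ0)) ∧
    (∀ (j : Fin J) (t : ℕ), t < T₀ →
      let s := inner ℝ (D.neuron η ω t j) D.vs
      let s' := inner ℝ (D.neuron η ω (t + 1) j) D.vs
      let c := inner ℝ (D.neuron η ω t j) D.vc
      let c' := inner ℝ (D.neuron η ω (t + 1) j) D.vc
      let αhat := groupProportion (D.dataset ω.1)
      (L⁻¹ * η) * D.βs ^ 3 * (2 * αhat - 1) * s ^ 2 ≤ s' - s ∧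
      s' - s ≤ (L * η) * D.βs ^ 3 * αhat * s ^ 2 ∧
      (L⁻¹ * η) * D.βc ^ 3 * αhat * c ^ 2 ≤ c' - c ∧
      c' - c ≤ (L * η) * D.βc ^ 3 * c ^ 2) ∧
    L⁻¹ * (1 / D.βs) ≤ ⨆ j, inner ℝ (D.neuron η ω T₀ j) D.vs ∧
    |⨆ j, inner ℝ (D.neuron η ω T₀ j) D.vc| ≤ L * σ0

end SpuriousCNN

end

open SpuriousCNN

/-!
Gradient descent moves each neuron `w_j` only along the two features and the noise patches, so it
suffices to follow the scalars `s_j = ⟨w_j, v_s⟩`, `c_j = ⟨w_j, v_c⟩` and `n_ji = ⟨w_j, ξ_i⟩`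
(`FeatureDynamics`). As long as all margins are small, the logistic weights are close to `1/2`, and
because a majority of the training data has `a = y`, the spurious coordinate grows like
`s' = s + Θ(η βs³) s²` and the core coordinate like `c' = c + Θ(η βc³) c²`, up to noise
(`Regime.goodStep_of_bounds`). Such a recursion moves the reciprocal of the coordinate linearly in
time (`quadratic_growth_lower`, `quadratic_growth_upper`, `quadratic_growth_neg`). Hence

* the best initialized neuron reaches the level `θ = 1 / (polylog · βs)` after about
  `1 / (η βs³ max_j s_j(0))` steps, which defines `T₀`;
* within that time `1 / c_j` moves by about `(βc / βs)³ / max_j s_j(0)`, less than half of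
  `1 / max_j c_j(0)` when `βc ≤ c βs`, because the two maxima have the same order;
* coordinates that start negative approach `0` slowly and stay of order `σ0 / polylog`, so that the
  squares dominate the noise at every step for every neuron. For the core feature this needs
  `βc³ σ0² ≫ σ0² / √d` up to logarithms, which is where `γ < 1/6` enters.

The noise correlations stay of order `σ0 polylog` (`Regime.noise_le_of_goodSteps`): the part of
their drift that comes from the features telescopes against the growth of `s_j` and `c_j` and
carries a factor `⟨v, ξ_i⟩ ≈ 1/√d`, and the part that comes from the noise itself carries a factor
`1/N + 1/√d`. These statements feed each other in a strong induction on time (`Regime.goodStep`),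
and `Regime.exists_time` is the resulting deterministic theorem.

The probabilistic input is a union bound (`measure_not_goodDraw_le`) over Gaussian tails, a small
ball estimate for the initial coordinates, a lower bound for the maximum of `J` Gaussians, and
Chebyshev's inequality for the majority. Since all Gaussian vectors involved are isotropic, every
event reduces to a one-dimensional Gaussian, by Fubini for inner products of independent vectors.
-/

open MeasureTheory ProbabilityTheory SpuriousCNN

namespace SpuriousCNN

/-! ### Gradient descent along a direction -/

section

/-- The weight `-ℓ'(z) = 1 / (1 + e^z)` with which a data point of margin `z` enters the
gradient of the logistic loss. -/
noncomputable def logisticWeight (z : ℝ) : ℝ := 1 / (1 + Real.exp z)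

lemma hasDerivAt_logisticLoss (z : ℝ) : HasDerivAt logisticLoss (-logisticWeight z) z := by
  have h1 : HasDerivAt (fun z : ℝ => 1 + Real.exp (-z)) (-Real.exp (-z)) z := by
    have := ((hasDerivAt_neg z).exp).const_add 1
    simpa using this
  have h2 := h1.log (by positivity)
  refine HasDerivAt.congr_deriv (f := logisticLoss) h2 ?_
  have := Real.exp_pos z
  simp only [logisticWeight, Real.exp_neg]
  field_simp
  ring

variable {N J d : ℕ}

lemma differentiable_cnn (x : Fin 3 → Patch d) :
    Differentiable ℝ (fun W : Weights J d => cnn W x) := by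
  have h : ∀ j, Differentiable ℝ (fun W : Weights J d => W j) := fun j =>
    (PiLp.proj 2 (fun _ : Fin J => Patch d) j : Weights J d →L[ℝ] Patch d).differentiable
  unfold cnn
  exact Differentiable.fun_sum fun j _ => Differentiable.fun_sum fun p _ =>
    ((h j).inner ℝ (differentiable_const _)).pow 3

lemma differentiable_empiricalLoss (S : Fin N → DataPoint d) :
    Differentiable ℝ (empiricalLoss S : Weights J d → ℝ) := by
  unfold empiricalLoss
  refine Differentiable.const_mul (Differentiable.fun_sum fun i _ => ?_) _
  have h : Differentiable ℝ logisticLoss := fun z => (hasDerivAt_logisticLoss z).differentiableAt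
  exact h.comp ((differentiable_cnn _).const_mul _)

lemma hasLineDerivAt_cnn (W V : Weights J d) (x : Fin 3 → Patch d) :
    HasLineDerivAt ℝ (fun W : Weights J d => cnn W x)
      (∑ j, ∑ p, 3 * inner ℝ (W j) (x p) ^ 2 * inner ℝ (V j) (x p)) W V := by
  unfold HasLineDerivAt cnn
  refine HasDerivAt.fun_sum fun j _ => HasDerivAt.fun_sum fun p _ => ?_
  have h : HasDerivAt (fun u : ℝ => inner ℝ ((W + u • V) j) (x p)) (inner ℝ (V j) (x p)) 0 := by
    have h1 := ((hasDerivAt_id (0 : ℝ)).mul_const (inner ℝ (V j) (x p))).const_add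
      (inner ℝ (W j) (x p))
    simp only [id, one_mul] at h1
    refine h1.congr_of_eventuallyEq (Filter.Eventually.of_forall fun u => ?_)
    simp [inner_add_left, real_inner_smul_left]
  exact (h.pow 3).congr_deriv (by simp)

lemma hasLineDerivAt_empiricalLoss (S : Fin N → DataPoint d) (W V : Weights J d) :
    HasLineDerivAt ℝ (empiricalLoss S : Weights J d → ℝ)
      (1 / (N : ℝ) * ∑ i, -logisticWeight ((S i).y * cnn W (S i).x) * ((S i).y *
        ∑ j, ∑ p, 3 * inner ℝ (W j) ((S i).x p) ^ 2 * inner ℝ (V j) ((S i).x p))) W V := by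
  unfold HasLineDerivAt empiricalLoss
  refine HasDerivAt.const_mul _ (HasDerivAt.fun_sum fun i _ => ?_)
  have h := (hasLineDerivAt_cnn W V (S i).x)
  unfold HasLineDerivAt at h
  have h2 := HasDerivAt.comp (0 : ℝ) (h₂ := logisticLoss)
    (h := fun u : ℝ => (S i).y * cnn (W + u • V) (S i).x)
    (hasDerivAt_logisticLoss _) (h.const_mul (S i).y)
  exact h2.congr_deriv (by simp)

/-- One step of gradient descent, seen along a direction `v`. -/
lemma inner_gd_succ (S : Fin N → DataPoint d) (η : ℝ) (W0 : Weights J d) (t : ℕ) (j : Fin J)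
    (v : Patch d) :
    inner ℝ (gd S η W0 (t + 1) j) v = inner ℝ (gd S η W0 t j) v +
      3 * η / N * ∑ i, logisticWeight ((S i).y * cnn (gd S η W0 t) (S i).x) *
        ((S i).y * ∑ p, inner ℝ (gd S η W0 t j) ((S i).x p) ^ 2 * inner ℝ ((S i).x p) v) := by
  set W := gd S η W0 t
  have hg : inner ℝ (gradient (empiricalLoss S) W j) v =
      fderiv ℝ (empiricalLoss S) W (PiLp.single 2 j v) := by
    rw [← inner_gradient_left, PiLp.inner_apply (f := fun _ : Fin J => Patch d),
      Finset.sum_eq_single j]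
    · simp
    · intro b _ hb; simp [hb]
    · simp
  rw [← (differentiable_empiricalLoss S W).lineDeriv_eq_fderiv,
    (hasLineDerivAt_empiricalLoss S W _).lineDeriv] at hg
  have : gd S η W0 (t + 1) j = W j - η • gradient (empiricalLoss S) W j := rfl
  rw [this, inner_sub_left, real_inner_smul_left, hg]
  have : ∀ i, (∑ j', ∑ p, 3 * inner ℝ (W j') ((S i).x p) ^ 2 *
      inner ℝ ((PiLp.single 2 j v : Weights J d) j') ((S i).x p)) =
      3 * ∑ p, inner ℝ (W j) ((S i).x p) ^ 2 * inner ℝ ((S i).x p) v := by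
    intro i
    rw [Finset.sum_eq_single j]
    · simp [Finset.mul_sum, mul_assoc, real_inner_comm]
    · intro b _ hb; simp [hb]
    · simp
  simp only [this]
  rw [sub_eq_add_neg]
  congr 1
  simp only [Finset.mul_sum, ← Finset.sum_neg_distrib]
  refine Finset.sum_congr rfl fun i _ => ?_
  refine Finset.sum_congr rfl fun p _ => ?_
  ring

variable (D : DataModel d)

lemma DataModel.sum_patches (z : Seed d) (g : Patch d → ℝ) :
    ∑ p, g ((D.dataPoint z).x p) =
      g ((D.βc * z.1) • D.vc) + g ((D.βs * (z.2.1 * z.1)) • D.vs) + g z.2.2.2 := by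
  have := Equiv.sum_comp z.2.2.1
    (fun p => g (![(D.βc * z.1) • D.vc, (D.βs * (z.2.1 * z.1)) • D.vs, z.2.2.2] p))
  simp only [DataModel.dataPoint]
  rw [this, Fin.sum_univ_three]
  simp

/-- The margin of a data point, split into core feature, spurious feature and noise. -/
lemma DataModel.margin_eq (z : Seed d) (hy : z.1 ^ 2 = 1) (hb : z.2.1 ^ 2 = 1)
    (W : Weights J d) :
    (D.dataPoint z).y * cnn W (D.dataPoint z).x =
      ∑ j, (D.βc ^ 3 * inner ℝ (W j) D.vc ^ 3 + z.2.1 * D.βs ^ 3 * inner ℝ (W j) D.vs ^ 3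
        + z.1 * inner ℝ (W j) z.2.2.2 ^ 3) := by
  unfold cnn
  rw [Finset.mul_sum]
  refine Finset.sum_congr rfl fun j _ => ?_
  rw [D.sum_patches z (fun x => inner ℝ (W j) x ^ 3)]
  simp only [real_inner_smul_right, DataModel.dataPoint]
  have h4 : z.1 ^ 4 = 1 := by rw [show (4 : ℕ) = 2 * 2 from rfl, pow_mul, hy, one_pow]
  have h3 : z.2.1 ^ 3 = z.2.1 := by rw [pow_succ, hb, one_mul]
  linear_combination (D.βc ^ 3 * inner ℝ (W j) D.vc ^ 3 +
    D.βs ^ 3 * inner ℝ (W j) D.vs ^ 3 * z.2.1 ^ 3) * h4 +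
    D.βs ^ 3 * inner ℝ (W j) D.vs ^ 3 * h3

lemma DataModel.gradient_term_eq (z : Seed d) (hy : z.1 ^ 2 = 1) (hb : z.2.1 ^ 2 = 1)
    (w v : Patch d) :
    (D.dataPoint z).y * ∑ p, inner ℝ w ((D.dataPoint z).x p) ^ 2 *
        inner ℝ ((D.dataPoint z).x p) v =
      D.βc ^ 3 * inner ℝ w D.vc ^ 2 * inner ℝ D.vc v +
      z.2.1 * D.βs ^ 3 * inner ℝ w D.vs ^ 2 * inner ℝ D.vs v +
      z.1 * inner ℝ w z.2.2.2 ^ 2 * inner ℝ z.2.2.2 v := by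
  rw [D.sum_patches z (fun x => inner ℝ w x ^ 2 * inner ℝ x v)]
  simp only [real_inner_smul_right, real_inner_smul_left, DataModel.dataPoint]
  have h4 : z.1 ^ 4 = 1 := by rw [show (4 : ℕ) = 2 * 2 from rfl, pow_mul, hy, one_pow]
  have h3 : z.2.1 ^ 3 = z.2.1 := by rw [pow_succ, hb, one_mul]
  linear_combination (D.βc ^ 3 * inner ℝ w D.vc ^ 2 * inner ℝ D.vc v +
    D.βs ^ 3 * inner ℝ w D.vs ^ 2 * inner ℝ D.vs v * z.2.1 ^ 3) * h4 +
    D.βs ^ 3 * inner ℝ w D.vs ^ 2 * inner ℝ D.vs v * h3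

end

/-! ### Sequences with quadratic increments -/

section

/-- If a positive sequence grows at least like `x' = x + a x²`, its reciprocal drops by at least
`a / 2` per step as long as `a x ≤ 1`. -/
lemma quadratic_growth_lower {x : ℕ → ℝ} {a : ℝ} (ha : 0 < a) (h0 : 0 < x 0) (t : ℕ)
    (h : ∀ u < t, x u + a * x u ^ 2 ≤ x (u + 1)) (hx : ∀ u < t, a * x u ≤ 1) :
    0 < x t ∧ t * a / 2 + 1 / x t ≤ 1 / x 0 := by
  induction t with
  | zero => simp [h0]
  | succ t ih =>
    obtain ⟨hp, ih⟩ := ih (fun u hu => h u (by omega)) (fun u hu => hx u (by omega))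
    have h1 := h t (by omega)
    have h2 := hx t (by omega)
    have hp' : 0 < x (t + 1) := by nlinarith [mul_pos ha (pow_pos hp 2)]
    refine ⟨hp', ?_⟩
    have key : 1 / x (t + 1) ≤ 1 / x t - a / 2 := by
      rw [div_sub_div _ _ hp.ne' two_ne_zero, div_le_div_iff₀ hp' (by positivity)]
      have : (2 - a * x t) * (x t + a * x t ^ 2) ≤ (2 - a * x t) * x (t + 1) :=
        mul_le_mul_of_nonneg_left h1 (by linarith)
      have h3 : 0 ≤ a * x t ^ 2 * (1 - a * x t) := by
        have : 0 ≤ 1 - a * x t := by linarith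
        positivity
      nlinarith
    push_cast
    linarith

/-- If a positive sequence grows at most like `x' = x + b x²`, its reciprocal drops by at most
`b` per step. -/
lemma quadratic_growth_upper {x : ℕ → ℝ} {b : ℝ} (hb : 0 < b) (h0 : 0 < x 0) (t : ℕ)
    (hm : ∀ u < t, x u ≤ x (u + 1)) (h : ∀ u < t, x (u + 1) ≤ x u + b * x u ^ 2) :
    x 0 ≤ x t ∧ 1 / x 0 ≤ 1 / x t + b * t := by
  induction t with
  | zero => simp
  | succ t ih =>
    obtain ⟨hp, ih⟩ := ih (fun u hu => hm u (by omega)) (fun u hu => h u (by omega))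
    have h1 := h t (by omega)
    have h2 := hm t (by omega)
    have hp0 : 0 < x t := by linarith
    have hp' : 0 < x (t + 1) := by linarith
    refine ⟨by linarith, ?_⟩
    have key : 1 / x t ≤ 1 / x (t + 1) + b := by
      rw [← sub_le_iff_le_add', div_sub_div _ _ hp0.ne' hp'.ne', div_le_iff₀ (by positivity)]
      nlinarith [mul_le_mul_of_nonneg_left h2 (by positivity : 0 ≤ b * x t)]
    push_cast
    linarith

/-- A negative sequence with `x ≤ x' ≤ x + b x²` stays negative and approaches `0` slowly. -/
lemma quadratic_growth_neg {x : ℕ → ℝ} {b : ℝ} (hb : 0 < b) (h0 : x 0 < 0)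
    (hb0 : b * (-x 0) ≤ 1 / 2) (t : ℕ)
    (hm : ∀ u < t, x u ≤ x (u + 1)) (h : ∀ u < t, x (u + 1) ≤ x u + b * x u ^ 2) :
    x 0 ≤ x t ∧ x t < 0 ∧ 1 / (-x t) ≤ 1 / (-x 0) + 2 * b * t := by
  induction t with
  | zero => simp [h0]
  | succ t ih =>
    obtain ⟨hp, hneg, ih⟩ := ih (fun u hu => hm u (by omega)) (fun u hu => h u (by omega))
    have h1 := h t (by omega)
    have h2 := hm t (by omega)
    obtain ⟨y, hy⟩ : ∃ y, x t = -y := ⟨-x t, by ring⟩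
    obtain ⟨y', hy'⟩ : ∃ y, x (t + 1) = -y := ⟨-x (t + 1), by ring⟩
    rw [hy] at hp hneg ih h1 h2
    rw [hy'] at h1 h2 ⊢
    simp only [neg_neg] at *
    have hy0 : 0 < y := by linarith
    have hby : b * y ≤ 1 / 2 := by nlinarith
    have hy'1 : y * (1 - b * y) ≤ y' := by nlinarith
    have hy'0 : 0 < y' := lt_of_lt_of_le (mul_pos hy0 (by linarith)) hy'1
    refine ⟨by linarith, by linarith, ?_⟩
    have key : 1 / y' ≤ 1 / y + 2 * b := by
      rw [← sub_le_iff_le_add', div_sub_div _ _ hy'0.ne' hy0.ne', div_le_iff₀ (by positivity)]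
      have h3 : 0 ≤ b * y ^ 2 * (1 - 2 * (b * y)) := by
        have : 0 ≤ 1 - 2 * (b * y) := by linarith
        positivity
      nlinarith [mul_le_mul_of_nonneg_left hy'1 (by positivity : 0 ≤ 1 + 2 * b * y)]
    push_cast
    linarith

/-- Two-sided control of a sequence with `x ≤ x' ≤ x + b x²` on a time span that is short
compared with `1 / (b S)`, where `S` bounds the initial value. -/
lemma quadratic_growth_bounds {x : ℕ → ℝ} {b S low0 low : ℝ} (hb : 0 < b) (hS : |x 0| ≤ S)
    (hlow0 : 0 < low0) (hx0 : low0 ≤ |x 0|) (hbS : b * S ≤ 1 / 2) (t : ℕ)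
    (hlow : 0 < low) (hl : 1 / low0 + 2 * b * t ≤ 1 / low)
    (hm : ∀ u < t, x u ≤ x (u + 1)) (h : ∀ u < t, x (u + 1) ≤ x u + b * x u ^ 2) :
    -S ≤ x t ∧ low ≤ |x t| ∧ (b * t * S ≤ 1 / 2 → x t ≤ 2 * S) := by
  have hle : low ≤ low0 := by
    rw [← one_div_le_one_div hlow0 hlow]
    have : 0 ≤ 2 * b * t := by positivity
    linarith
  have hSpos : 0 < S := by linarith
  rcases lt_or_ge 0 (x 0) with h0 | h0
  · obtain ⟨h1, h2⟩ := quadratic_growth_upper hb h0 t hm h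
    rw [abs_of_pos h0] at hS hx0
    have hp : 0 < x t := by linarith
    refine ⟨by linarith, by rw [abs_of_pos hp]; linarith, fun h3 => ?_⟩
    have h4 : 1 / S ≤ 1 / x 0 := one_div_le_one_div_of_le h0 hS
    have h5 : b * t ≤ 1 / (2 * S) := by
      rw [le_div_iff₀ (by positivity)]; linarith
    have h6 : 1 / (2 * S) = 1 / S / 2 := by field_simp
    have h7 : 1 / (2 * S) ≤ 1 / x t := by linarith
    exact (one_div_le_one_div (by positivity) hp).1 h7
  · have h0' : x 0 < 0 := by
      rcases h0.lt_or_eq with h | h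
      · exact h
      · rw [h] at hx0; simp at hx0; linarith
    rw [abs_of_neg h0'] at hS hx0
    obtain ⟨h1, h2, h3⟩ := quadratic_growth_neg hb h0' (by nlinarith) t hm h
    refine ⟨by linarith, ?_, fun _ => by linarith⟩
    rw [abs_of_neg h2, ← one_div_le_one_div (by linarith) hlow]
    have := one_div_le_one_div_of_le hlow0 hx0
    linarith

end

/-! ### Deterministic analysis of the feature dynamics -/

section

/-- Gradient descent in the coordinates that matter: the correlations of the neurons with the two
features and with the noise patches. The Gram data of the noise patches enter as constants. -/
structure FeatureDynamics (N J : ℕ) where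
  η : ℝ
  βc : ℝ
  βs : ℝ
  /-- the labels -/
  y : Fin N → ℝ
  /-- the signs `a * y` -/
  b : Fin N → ℝ
  /-- correlation of the noise patches with the spurious feature -/
  us : Fin N → ℝ
  /-- correlation of the noise patches with the core feature -/
  uc : Fin N → ℝ
  /-- Gram matrix of the noise patches -/
  g : Fin N → Fin N → ℝ
  /-- spurious feature coordinates of the neurons -/
  s : ℕ → Fin J → ℝ
  /-- core feature coordinates of the neurons -/
  c : ℕ → Fin J → ℝ
  /-- correlations of the neurons with the noise patches -/
  n : ℕ → Fin J → Fin N → ℝ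
  /-- weights of the data points in the gradient -/
  l : ℕ → Fin N → ℝ
  l_eq : ∀ t i, l t i = logisticWeight
    (∑ j, (βc ^ 3 * c t j ^ 3 + b i * βs ^ 3 * s t j ^ 3 + y i * n t j i ^ 3))
  s_succ : ∀ t j, s (t + 1) j = s t j + 3 * η / N *
    ∑ i, l t i * (b i * βs ^ 3 * s t j ^ 2 + y i * n t j i ^ 2 * us i)
  c_succ : ∀ t j, c (t + 1) j = c t j + 3 * η / N *
    ∑ i, l t i * (βc ^ 3 * c t j ^ 2 + y i * n t j i ^ 2 * uc i)
  n_succ : ∀ t j k, n (t + 1) j k = n t j k + 3 * η / N *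
    ∑ i, l t i * (βc ^ 3 * c t j ^ 2 * uc k + b i * βs ^ 3 * s t j ^ 2 * us k
      + y i * n t j i ^ 2 * g i k)

/-- Quantitative assumptions on data, initialization and scales. `κ` is the majority margin, `θ`
the level at which the spurious feature counts as learned, `ρ` the bound to be maintained on the
noise correlations, `S` and `low0` the largest and smallest initial feature correlation, `low`
the lower bound to be maintained, `m0` a lower bound for the best initial spurious correlation,
`τ`, `τ'`, `ν` bounds on the Gram data of the noise and `n0` on the initial noise correlations. -/
structure FeatureDynamics.Regime {N J : ℕ} (F : FeatureDynamics N J)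
    (κ θ ρ S low0 low m0 τ τ' ν n0 : ℝ) : Prop where
  N_pos : 0 < N
  η_pos : 0 < F.η
  η_le : F.η ≤ 1
  βc_pos : 0 < F.βc
  βs_pos : 0 < F.βs
  βc_le : F.βc ≤ F.βs
  y_sign : ∀ i, |F.y i| = 1
  b_sign : ∀ i, |F.b i| = 1
  κ_pos : 0 < κ
  κ_le : κ ≤ 1
  sum_b : κ / 2 * N ≤ ∑ i, F.b i
  us_le : ∀ i, |F.us i| ≤ τ
  uc_le : ∀ i, |F.uc i| ≤ τ
  g_le : ∀ i k, i ≠ k → |F.g i k| ≤ τ'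
  g_diag : ∀ i, |F.g i i| ≤ ν
  τ_nonneg : 0 ≤ τ
  s_le : ∀ j, |F.s 0 j| ≤ S
  c_le : ∀ j, |F.c 0 j| ≤ S
  s_ge : ∀ j, low0 ≤ |F.s 0 j|
  c_ge : ∀ j, low0 ≤ |F.c 0 j|
  n_le : ∀ j i, |F.n 0 j i| ≤ n0
  low0_pos : 0 < low0
  low_pos : 0 < low
  m0_pos : 0 < m0
  S_pos : 0 < S
  exists_large : ∃ j, m0 ≤ F.s 0 j
  low_le : 1 / low0 + 64 / (κ * m0) ≤ 1 / low
  separation : 64 * F.βc ^ 3 * S ≤ κ * F.βs ^ 3 * m0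
  θ_le : F.βs ^ 3 * θ ≤ 1
  S_lt : 2 * S < θ
  S_small : 8 * F.βs ^ 3 * S ≤ 1
  margin_small : J * (F.βs ^ 3 * θ ^ 3 + 8 * F.βc ^ 3 * S ^ 3 + ρ ^ 3) ≤ κ / 8
  noise_s : 3 * ρ ^ 2 * τ ≤ κ / 8 * F.βs ^ 3 * low ^ 2
  noise_c : 3 * ρ ^ 2 * τ ≤ 1 / 4 * F.βc ^ 3 * low ^ 2
  noise_n : n0 + 3 * τ * (8 * θ / κ + 6 * S)
    + 3 * (8 / (κ * F.βs ^ 3 * m0)) * (ρ ^ 2 * (ν / N + τ')) ≤ ρ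

lemma logisticWeight_pos (z : ℝ) : 0 < logisticWeight z := by
  unfold logisticWeight; positivity

lemma logisticWeight_le_one (z : ℝ) : logisticWeight z ≤ 1 := by
  unfold logisticWeight
  rw [div_le_one (by positivity)]
  linarith [Real.exp_pos z]

lemma abs_logisticWeight_sub_half_le {z e : ℝ} (he : e ≤ 1) (hz : |z| ≤ e) :
    |logisticWeight z - 1 / 2| ≤ e := by
  have h0 : 0 ≤ e := (abs_nonneg z).trans hz
  have h1 : |Real.exp z - 1| ≤ 2 * |z| := Real.abs_exp_sub_one_le (hz.trans he)
  have hE := Real.exp_pos z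
  have : logisticWeight z - 1 / 2 = (1 - Real.exp z) / (2 * (1 + Real.exp z)) := by
    unfold logisticWeight; field_simp; ring
  rw [this, abs_div, abs_of_pos (by positivity : 0 < 2 * (1 + Real.exp z)),
    div_le_iff₀ (by positivity), abs_sub_comm]
  nlinarith

namespace FeatureDynamics

variable {N J : ℕ} (F : FeatureDynamics N J)

/-- The growth bounds for step `t`. -/
def GoodStep (κ : ℝ) (t : ℕ) : Prop := ∀ j,
  κ / 4 * F.η * F.βs ^ 3 * F.s t j ^ 2 ≤ F.s (t + 1) j - F.s t j ∧
  F.s (t + 1) j - F.s t j ≤ 4 * F.η * F.βs ^ 3 * F.s t j ^ 2 ∧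
  1 / 2 * F.η * F.βc ^ 3 * F.c t j ^ 2 ≤ F.c (t + 1) j - F.c t j ∧
  F.c (t + 1) j - F.c t j ≤ 4 * F.η * F.βc ^ 3 * F.c t j ^ 2

variable {F} {κ θ ρ S low0 low m0 τ τ' ν n0 : ℝ}

lemma abs_weighted_sum_le {l e : Fin N → ℝ} {B : ℝ} (hN : 0 < N)
    (h0 : ∀ i, 0 ≤ l i) (h1 : ∀ i, l i ≤ 1) (he : ∀ i, |e i| ≤ B) :
    |(∑ i, l i * e i) / N| ≤ B := by
  have hN' : (0 : ℝ) < N := by exact_mod_cast hN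
  rw [abs_div, abs_of_pos hN', div_le_iff₀ hN']
  calc |∑ i, l i * e i| ≤ ∑ i, |l i * e i| := Finset.abs_sum_le_sum_abs _ _
    _ ≤ ∑ _i : Fin N, B := Finset.sum_le_sum fun i _ => by
      rw [abs_mul, abs_of_nonneg (h0 i)]
      nlinarith [abs_nonneg (e i), he i, h0 i, h1 i]
    _ = B * N := by simp [mul_comm]

lemma l_mem (t : ℕ) (i : Fin N) : 0 ≤ F.l t i ∧ F.l t i ≤ 1 := by
  rw [F.l_eq]
  exact ⟨(logisticWeight_pos _).le, logisticWeight_le_one _⟩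

lemma Regime.abs_l_sub_half_le (R : F.Regime κ θ ρ S low0 low m0 τ τ' ν n0) {t : ℕ}
    (hs : ∀ j, |F.s t j| ≤ θ) (hc : ∀ j, |F.c t j| ≤ 2 * S)
    (hn : ∀ j i, |F.n t j i| ≤ ρ) (i : Fin N) : |F.l t i - 1 / 2| ≤ κ / 8 := by
  rw [F.l_eq]
  refine abs_logisticWeight_sub_half_le (by linarith [R.κ_le]) ?_
  have hβc := R.βc_pos
  have hβs := R.βs_pos
  have cube : ∀ {x B : ℝ}, |x| ≤ B → |x ^ 3| ≤ B ^ 3 := fun {x B} h => by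
    rw [abs_pow]; exact pow_le_pow_left₀ (abs_nonneg x) h 3
  calc |∑ j, (F.βc ^ 3 * F.c t j ^ 3 + F.b i * F.βs ^ 3 * F.s t j ^ 3 + F.y i * F.n t j i ^ 3)|
      ≤ ∑ j, |F.βc ^ 3 * F.c t j ^ 3 + F.b i * F.βs ^ 3 * F.s t j ^ 3
          + F.y i * F.n t j i ^ 3| := Finset.abs_sum_le_sum_abs _ _
    _ ≤ ∑ _j : Fin J, (F.βs ^ 3 * θ ^ 3 + 8 * F.βc ^ 3 * S ^ 3 + ρ ^ 3) :=
      Finset.sum_le_sum fun j _ => by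
        have h1 : |F.βc ^ 3 * F.c t j ^ 3| ≤ F.βc ^ 3 * (2 * S) ^ 3 := by
          rw [abs_mul, abs_of_pos (by positivity : 0 < F.βc ^ 3)]
          exact mul_le_mul_of_nonneg_left (cube (hc j)) (by positivity)
        have h2 : |F.b i * F.βs ^ 3 * F.s t j ^ 3| ≤ F.βs ^ 3 * θ ^ 3 := by
          rw [abs_mul, abs_mul, R.b_sign, one_mul, abs_of_pos (by positivity : 0 < F.βs ^ 3)]
          exact mul_le_mul_of_nonneg_left (cube (hs j)) (by positivity)
        have h3 : |F.y i * F.n t j i ^ 3| ≤ ρ ^ 3 := by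
          rw [abs_mul, R.y_sign, one_mul]
          exact cube (hn j i)
        have := abs_add_three (F.βc ^ 3 * F.c t j ^ 3) (F.b i * F.βs ^ 3 * F.s t j ^ 3)
          (F.y i * F.n t j i ^ 3)
        nlinarith
    _ = J * (F.βs ^ 3 * θ ^ 3 + 8 * F.βc ^ 3 * S ^ 3 + ρ ^ 3) := by
      simp only [Finset.sum_const, Finset.card_univ, Fintype.card_fin, nsmul_eq_mul]
    _ ≤ κ / 8 := R.margin_small

/-- The increments of one step, while the margins are small and the noise is dominated. -/
lemma Regime.goodStep_of_bounds (R : F.Regime κ θ ρ S low0 low m0 τ τ' ν n0) {t : ℕ}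
    (hs : ∀ j, |F.s t j| ≤ θ) (hc : ∀ j, |F.c t j| ≤ 2 * S)
    (hn : ∀ j i, |F.n t j i| ≤ ρ) (hs' : ∀ j, low ≤ |F.s t j|) (hc' : ∀ j, low ≤ |F.c t j|) :
    F.GoodStep κ t := by
  have hl := R.abs_l_sub_half_le hs hc hn
  have hN' : (0 : ℝ) < N := by exact_mod_cast R.N_pos
  have hβc := R.βc_pos
  have hβs := R.βs_pos
  have hη := R.η_pos
  have hκ := R.κ_pos
  -- the noise contribution to a step, for either feature
  have noise : ∀ (u : Fin N → ℝ), (∀ i, |u i| ≤ τ) → ∀ j,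
      |(∑ i, F.l t i * (F.y i * F.n t j i ^ 2 * u i)) / N| ≤ ρ ^ 2 * τ := fun u hu j => by
    refine abs_weighted_sum_le R.N_pos (fun i => (l_mem t i).1) (fun i => (l_mem t i).2)
      fun i => ?_
    rw [abs_mul, abs_mul, R.y_sign, one_mul, abs_pow]
    exact mul_le_mul (pow_le_pow_left₀ (abs_nonneg _) (hn j i) 2) (hu i) (abs_nonneg _)
      (by positivity)
  have sq_low : ∀ x : ℝ, low ≤ |x| → low ^ 2 ≤ x ^ 2 := fun x hx => by
    rw [← sq_abs x]; exact pow_le_pow_left₀ R.low_pos.le hx 2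
  have hA1 : (∑ i, F.l t i * F.b i) / N ≤ 1 :=
    (abs_le.1 (abs_weighted_sum_le R.N_pos (fun i => (l_mem t i).1) (fun i => (l_mem t i).2)
      fun i => (R.b_sign i).le)).2
  have hA2 : κ / 8 ≤ (∑ i, F.l t i * F.b i) / N := by
    rw [le_div_iff₀ hN']
    have h1 : ∀ i, F.b i / 2 - κ / 8 ≤ F.l t i * F.b i := fun i => by
      have := abs_le.1 (show |(F.l t i - 1 / 2) * F.b i| ≤ κ / 8 by
        rw [abs_mul, R.b_sign, mul_one]; exact hl i)
      linarith [this.1]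
    have h2 := Finset.sum_le_sum fun i (_ : i ∈ Finset.univ) => h1 i
    rw [Finset.sum_sub_distrib, ← Finset.sum_div] at h2
    simp only [Finset.sum_const, Finset.card_univ, Fintype.card_fin, nsmul_eq_mul] at h2
    linarith [R.sum_b]
  have hB1 : (∑ i, F.l t i) / N ≤ 1 := by
    have := abs_weighted_sum_le (l := F.l t) (e := fun _ => 1) (B := 1) R.N_pos
      (fun i => (l_mem t i).1) (fun i => (l_mem t i).2) (by simp)
    simpa using (abs_le.1 this).2
  have hB2 : 1 / 4 ≤ (∑ i, F.l t i) / N := by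
    rw [le_div_iff₀ hN']
    have h2 := Finset.sum_le_sum fun i (_ : i ∈ Finset.univ) =>
      (show 1 / 4 ≤ F.l t i by linarith [(abs_le.1 (hl i)).1, R.κ_le])
    simp only [Finset.sum_const, Finset.card_univ, Fintype.card_fin, nsmul_eq_mul] at h2
    linarith
  intro j
  have es : F.s (t + 1) j - F.s t j = 3 * F.η * ((∑ i, F.l t i * F.b i) / N *
      (F.βs ^ 3 * F.s t j ^ 2) + (∑ i, F.l t i * (F.y i * F.n t j i ^ 2 * F.us i)) / N) := by
    rw [F.s_succ, add_sub_cancel_left]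
    simp only [mul_add, Finset.sum_add_distrib, Finset.sum_div, Finset.sum_mul, Finset.mul_sum]
    congr 1 <;> exact Finset.sum_congr rfl fun i _ => by ring
  have ec : F.c (t + 1) j - F.c t j = 3 * F.η * ((∑ i, F.l t i) / N *
      (F.βc ^ 3 * F.c t j ^ 2) + (∑ i, F.l t i * (F.y i * F.n t j i ^ 2 * F.uc i)) / N) := by
    rw [F.c_succ, add_sub_cancel_left]
    simp only [mul_add, Finset.sum_add_distrib, Finset.sum_div, Finset.sum_mul, Finset.mul_sum]
    congr 1 <;> exact Finset.sum_congr rfl fun i _ => by ring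
  have ns := abs_le.1 (noise F.us R.us_le j)
  have nc := abs_le.1 (noise F.uc R.uc_le j)
  set A := (∑ i, F.l t i * F.b i) / (N : ℝ)
  set B := (∑ i, F.l t i) / (N : ℝ)
  set X := (∑ i, F.l t i * (F.y i * F.n t j i ^ 2 * F.us i)) / (N : ℝ)
  set Y := (∑ i, F.l t i * (F.y i * F.n t j i ^ 2 * F.uc i)) / (N : ℝ)
  set P := F.βs ^ 3 * F.s t j ^ 2 with hP
  set Q := F.βc ^ 3 * F.c t j ^ 2 with hQ
  have hP0 : 0 ≤ P := by positivity
  have hQ0 : 0 ≤ Q := by positivity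
  have bs : 3 * (ρ ^ 2 * τ) ≤ κ / 8 * P := by
    have := mul_le_mul_of_nonneg_left (sq_low _ (hs' j)) (by positivity : 0 ≤ κ / 8 * F.βs ^ 3)
    linarith [R.noise_s]
  have bc : 3 * (ρ ^ 2 * τ) ≤ 1 / 4 * Q := by
    have := mul_le_mul_of_nonneg_left (sq_low _ (hc' j)) (by positivity : 0 ≤ 1 / 4 * F.βc ^ 3)
    linarith [R.noise_c]
  have a1 : κ / 8 * P ≤ A * P := mul_le_mul_of_nonneg_right hA2 hP0
  have a2 : A * P ≤ P := by nlinarith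
  have a3 : 1 / 4 * Q ≤ B * Q := mul_le_mul_of_nonneg_right hB2 hQ0
  have a4 : B * Q ≤ Q := by nlinarith
  have a5 : κ / 8 * P ≤ P := by nlinarith [R.κ_le]
  rw [es, ec]
  refine ⟨?_, ?_, ?_, ?_⟩
  · calc κ / 4 * F.η * F.βs ^ 3 * F.s t j ^ 2 = F.η * (κ / 4 * P) := by rw [hP]; ring
      _ ≤ F.η * (3 * (A * P + X)) := mul_le_mul_of_nonneg_left (by linarith) hη.le
      _ = _ := by ring
  · calc 3 * F.η * (A * P + X) = F.η * (3 * (A * P + X)) := by ring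
      _ ≤ F.η * (4 * P) := mul_le_mul_of_nonneg_left (by linarith) hη.le
      _ = _ := by rw [hP]; ring
  · calc 1 / 2 * F.η * F.βc ^ 3 * F.c t j ^ 2 = F.η * (1 / 2 * Q) := by rw [hQ]; ring
      _ ≤ F.η * (3 * (B * Q + Y)) := mul_le_mul_of_nonneg_left (by linarith) hη.le
      _ = _ := by ring
  · calc 3 * F.η * (B * Q + Y) = F.η * (3 * (B * Q + Y)) := by ring
      _ ≤ F.η * (4 * Q) := mul_le_mul_of_nonneg_left (by linarith) hη.le
      _ = _ := by rw [hQ]; ring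

/-- One step changes the noise correlations by little: through the nearly orthogonal features,
through the pattern itself with weight `1 / N`, and through the other, nearly orthogonal noise
patches. -/
lemma Regime.abs_noise_step_le (R : F.Regime κ θ ρ S low0 low m0 τ τ' ν n0) {t : ℕ}
    (hτ' : 0 ≤ τ') (hn : ∀ j i, |F.n t j i| ≤ ρ) (j : Fin J) (k : Fin N) :
    |F.n (t + 1) j k - F.n t j k| ≤ 3 * F.η * (τ * (F.βc ^ 3 * F.c t j ^ 2)
      + τ * (F.βs ^ 3 * F.s t j ^ 2) + ρ ^ 2 * (ν / N + τ')) := by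
  have hN' : (0 : ℝ) < N := by exact_mod_cast R.N_pos
  have hβc := R.βc_pos
  have hβs := R.βs_pos
  have hη := R.η_pos
  have hτ := R.τ_nonneg
  have e : F.n (t + 1) j k - F.n t j k = 3 * F.η * ((∑ i, F.l t i *
      (F.βc ^ 3 * F.c t j ^ 2 * F.uc k + F.b i * F.βs ^ 3 * F.s t j ^ 2 * F.us k)) / N
      + (∑ i, F.l t i * (F.y i * F.n t j i ^ 2 * F.g i k)) / N) := by
    rw [F.n_succ, add_sub_cancel_left]
    simp only [mul_add, add_div, Finset.sum_add_distrib, Finset.sum_div, Finset.mul_sum]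
    congr 1
    · congr 1 <;> exact Finset.sum_congr rfl fun i _ => by ring
    · exact Finset.sum_congr rfl fun i _ => by ring
  have h1 : |(∑ i, F.l t i * (F.βc ^ 3 * F.c t j ^ 2 * F.uc k
      + F.b i * F.βs ^ 3 * F.s t j ^ 2 * F.us k)) / N| ≤
      τ * (F.βc ^ 3 * F.c t j ^ 2) + τ * (F.βs ^ 3 * F.s t j ^ 2) := by
    refine abs_weighted_sum_le R.N_pos (fun i => (l_mem t i).1) (fun i => (l_mem t i).2)
      fun i => (abs_add_le _ _).trans (add_le_add ?_ ?_)
    · rw [abs_mul, mul_comm, abs_of_nonneg (by positivity : 0 ≤ F.βc ^ 3 * F.c t j ^ 2)]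
      exact mul_le_mul_of_nonneg_right (R.uc_le k) (by positivity)
    · rw [abs_mul, mul_comm, mul_assoc, abs_mul (F.b i), R.b_sign, one_mul,
        abs_of_nonneg (by positivity : 0 ≤ F.βs ^ 3 * F.s t j ^ 2)]
      exact mul_le_mul_of_nonneg_right (R.us_le k) (by positivity)
  have hterm : ∀ i, |F.l t i * (F.y i * F.n t j i ^ 2 * F.g i k)| ≤
      ρ ^ 2 * |F.g i k| := fun i => by
    rw [abs_mul, abs_of_nonneg (l_mem t i).1, abs_mul, abs_mul, R.y_sign, one_mul, abs_pow]
    have h3 : |F.n t j i| ^ 2 * |F.g i k| ≤ ρ ^ 2 * |F.g i k| :=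
      mul_le_mul_of_nonneg_right (pow_le_pow_left₀ (abs_nonneg _) (hn j i) 2) (abs_nonneg _)
    have := mul_le_of_le_one_left (by positivity : 0 ≤ |F.n t j i| ^ 2 * |F.g i k|)
      (l_mem (F := F) t i).2
    linarith
  have h2 : |(∑ i, F.l t i * (F.y i * F.n t j i ^ 2 * F.g i k)) / N| ≤
      ρ ^ 2 * (ν / N + τ') := by
    rw [abs_div, abs_of_pos hN', div_le_iff₀ hN']
    calc |∑ i, F.l t i * (F.y i * F.n t j i ^ 2 * F.g i k)|
        ≤ ∑ i, |F.l t i * (F.y i * F.n t j i ^ 2 * F.g i k)| := Finset.abs_sum_le_sum_abs _ _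
      _ ≤ ∑ i, ((if i = k then ρ ^ 2 * ν else 0) + ρ ^ 2 * τ') :=
        Finset.sum_le_sum fun i _ => by
          refine (hterm i).trans ?_
          split_ifs with hik
          · subst hik
            have := mul_le_mul_of_nonneg_left (R.g_diag i) (sq_nonneg ρ)
            have : 0 ≤ ρ ^ 2 * τ' := by positivity
            linarith
          · rw [zero_add]
            exact mul_le_mul_of_nonneg_left (R.g_le i k hik) (sq_nonneg ρ)
      _ = ρ ^ 2 * (ν / N + τ') * N := by
        rw [Finset.sum_add_distrib]
        simp only [Finset.sum_ite_eq', Finset.mem_univ, if_true, Finset.sum_const,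
          Finset.card_univ, Fintype.card_fin, nsmul_eq_mul]
        field_simp
  rw [e, abs_mul, abs_of_pos (by positivity : 0 < 3 * F.η)]
  refine mul_le_mul_of_nonneg_left ((abs_add_le _ _).trans (add_le_add h1 h2)) (by positivity)

/-- The best initialized neuron forces an upper bound on the length of any period of good steps
during which the level `θ` is not reached. -/
lemma Regime.time_le (R : F.Regime κ θ ρ S low0 low m0 τ τ' ν n0) {t : ℕ}
    (hg : ∀ u < t, F.GoodStep κ u) (hθ : ∀ u < t, ∀ j, F.s u j < θ) :
    F.η * t ≤ 8 / (κ * F.βs ^ 3 * m0) := by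
  obtain ⟨j, hj⟩ := R.exists_large
  have hβs := R.βs_pos
  have hη := R.η_pos
  have hκ := R.κ_pos
  have hm0 := R.m0_pos
  obtain ⟨hpos, h⟩ := quadratic_growth_lower (x := fun u => F.s u j)
    (a := κ / 4 * F.η * F.βs ^ 3) (by positivity) (by linarith) t
    (fun u hu => by have := (hg u hu j).1; linarith)
    (fun u hu => by
      have h1 := (hθ u hu j).le
      have h2 : F.βs ^ 3 * F.s u j ≤ 1 :=
        (mul_le_mul_of_nonneg_left h1 (by positivity)).trans R.θ_le
      have h3 : κ / 4 * F.η ≤ 1 := by nlinarith [R.η_le, R.κ_le]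
      have h4 : 0 ≤ κ / 4 * F.η := by positivity
      calc κ / 4 * F.η * F.βs ^ 3 * F.s u j = κ / 4 * F.η * (F.βs ^ 3 * F.s u j) := by ring
        _ ≤ κ / 4 * F.η * 1 := mul_le_mul_of_nonneg_left h2 h4
        _ ≤ 1 := by linarith)
  have h1 : 0 < 1 / F.s t j := by positivity
  have h2 : 1 / F.s 0 j ≤ 1 / m0 := one_div_le_one_div_of_le hm0 hj
  have h3 : t * (κ / 4 * F.η * F.βs ^ 3) / 2 ≤ 1 / m0 := by
    linarith
  rw [le_div_iff₀ (by positivity)] at h3 ⊢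
  linarith

/-- Size of all coordinates after a period of good steps below the level `θ`. -/
lemma Regime.bounds_of_goodSteps (R : F.Regime κ θ ρ S low0 low m0 τ τ' ν n0) {t : ℕ}
    (hg : ∀ u < t, F.GoodStep κ u) (hθ : ∀ u < t, ∀ j, F.s u j < θ) (j : Fin J) :
    -S ≤ F.s t j ∧ low ≤ |F.s t j| ∧ (8 * F.η * F.βs ^ 3 * S * t ≤ 1 → F.s t j ≤ 2 * S) ∧
    -S ≤ F.c t j ∧ low ≤ |F.c t j| ∧ F.c t j ≤ 2 * S := by
  have hβs := R.βs_pos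
  have hβc := R.βc_pos
  have hη := R.η_pos
  have hκ := R.κ_pos
  have hm0 := R.m0_pos
  have hS := R.S_pos
  have hT := R.time_le hg hθ
  have hβ3 : F.βc ^ 3 ≤ F.βs ^ 3 := pow_le_pow_left₀ hβc.le R.βc_le 3
  have hTs : F.βs ^ 3 * (F.η * t) ≤ 8 / (κ * m0) := by
    rw [le_div_iff₀ (by positivity)] at hT ⊢
    linarith
  have hTc : F.βc ^ 3 * (F.η * t) ≤ 8 / (κ * m0) :=
    (mul_le_mul_of_nonneg_right hβ3 (by positivity)).trans hTs
  have e64 : (64 : ℝ) / (κ * m0) = 8 * (8 / (κ * m0)) := by ring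
  have hlow := R.low_le
  have hSs : F.η * (8 * F.βs ^ 3 * S) ≤ 1 := by
    have := mul_le_mul R.η_le R.S_small (by positivity) zero_le_one
    linarith
  have hSc : F.η * (8 * F.βc ^ 3 * S) ≤ 1 := by
    refine le_trans ?_ hSs
    have : F.βc ^ 3 * S ≤ F.βs ^ 3 * S := mul_le_mul_of_nonneg_right hβ3 hS.le
    exact mul_le_mul_of_nonneg_left (by linarith) hη.le
  obtain ⟨s1, s2, s3⟩ := quadratic_growth_bounds (x := fun u => F.s u j)
    (b := 4 * F.η * F.βs ^ 3) (S := S) (by positivity) (R.s_le j) R.low0_pos (R.s_ge j)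
    (by linarith) t R.low_pos (by linarith)
    (fun u hu => by
      have := (hg u hu j).1
      have : 0 ≤ κ / 4 * F.η * F.βs ^ 3 * F.s u j ^ 2 := by positivity
      linarith)
    (fun u hu => by have := (hg u hu j).2.1; linarith)
  obtain ⟨c1, c2, c3⟩ := quadratic_growth_bounds (x := fun u => F.c u j)
    (b := 4 * F.η * F.βc ^ 3) (S := S) (by positivity) (R.c_le j) R.low0_pos (R.c_ge j)
    (by linarith) t R.low_pos (by linarith)
    (fun u hu => by
      have := (hg u hu j).2.2.1
      have : 0 ≤ 1 / 2 * F.η * F.βc ^ 3 * F.c u j ^ 2 := by positivity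
      linarith)
    (fun u hu => by have := (hg u hu j).2.2.2; linarith)
  refine ⟨s1, s2, fun h => s3 (by linarith), c1, c2, c3 ?_⟩
  -- this is where `βc` has to be small compared with `βs`
  have h1 : F.βc ^ 3 * S * (F.η * t) ≤ κ * F.βs ^ 3 * m0 / 64 * (F.η * t) :=
    mul_le_mul_of_nonneg_right (by linarith [R.separation]) (by positivity)
  have h2 : κ * F.βs ^ 3 * m0 / 64 * (F.η * t) ≤ κ * F.βs ^ 3 * m0 / 64 *
      (8 / (κ * F.βs ^ 3 * m0)) := mul_le_mul_of_nonneg_left hT (by positivity)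
  have h3 : κ * F.βs ^ 3 * m0 / 64 * (8 / (κ * F.βs ^ 3 * m0)) = 1 / 8 := by
    field_simp; norm_num
  linarith

/-- The noise correlations stay below `ρ`: the feature contributions telescope, the rest is
controlled by the length of the period. -/
lemma Regime.noise_le_of_goodSteps (R : F.Regime κ θ ρ S low0 low m0 τ τ' ν n0) {t : ℕ}
    (hτ' : 0 ≤ τ') (hν : 0 ≤ ν)
    (hg : ∀ u < t, F.GoodStep κ u) (hθ : ∀ u ≤ t, ∀ j, F.s u j < θ)
    (hn : ∀ u < t, ∀ j i, |F.n u j i| ≤ ρ) (j : Fin J) (k : Fin N) : |F.n t j k| ≤ ρ := by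
  have hβs := R.βs_pos
  have hβc := R.βc_pos
  have hη := R.η_pos
  have hκ := R.κ_pos
  have hτ := R.τ_nonneg
  have key : ∀ v ≤ t, |F.n v j k| ≤ |F.n 0 j k| + 3 * τ * (4 / κ * (F.s v j - F.s 0 j)
      + 2 * (F.c v j - F.c 0 j)) + 3 * (F.η * v) * (ρ ^ 2 * (ν / N + τ')) := by
    intro v hv
    induction v with
    | zero => simp
    | succ v ih =>
      have ih := ih (by omega)
      have h1 := R.abs_noise_step_le hτ' (hn v (by omega)) j k
      have h2 : |F.n (v + 1) j k| ≤ |F.n v j k| + |F.n (v + 1) j k - F.n v j k| := by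
        have := abs_add_le (F.n v j k) (F.n (v + 1) j k - F.n v j k)
        rwa [add_sub_cancel] at this
      obtain ⟨g1, -, g3, -⟩ := hg v (by omega) j
      have g1' : F.η * (F.βs ^ 3 * F.s v j ^ 2) ≤ 4 / κ * (F.s (v + 1) j - F.s v j) := by
        rw [div_mul_eq_mul_div, le_div_iff₀ hκ]; linarith
      have g3' : F.η * (F.βc ^ 3 * F.c v j ^ 2) ≤ 2 * (F.c (v + 1) j - F.c v j) := by linarith
      have g1'' := mul_le_mul_of_nonneg_left g1' hτ
      have g3'' := mul_le_mul_of_nonneg_left g3' hτ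
      push_cast
      linarith
  have h := key t le_rfl
  obtain ⟨-, -, -, -, -, hc⟩ := R.bounds_of_goodSteps hg (fun u hu => hθ u hu.le) j
  have hT := R.time_le hg (fun u hu => hθ u hu.le)
  have hs0 := (abs_le.1 (R.s_le j)).1
  have hc0 := (abs_le.1 (R.c_le j)).1
  have hst := (hθ t le_rfl j).le
  have h1 : 4 / κ * (F.s t j - F.s 0 j) ≤ 8 * θ / κ := by
    rw [div_mul_eq_mul_div, div_le_div_iff_of_pos_right hκ]
    linarith [R.S_lt, R.S_pos]
  have h2 : 3 * τ * (4 / κ * (F.s t j - F.s 0 j) + 2 * (F.c t j - F.c 0 j)) ≤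
      3 * τ * (8 * θ / κ + 6 * S) :=
    mul_le_mul_of_nonneg_left (by linarith) (by positivity)
  have h3 : 3 * (F.η * t) * (ρ ^ 2 * (ν / N + τ')) ≤
      3 * (8 / (κ * F.βs ^ 3 * m0)) * (ρ ^ 2 * (ν / N + τ')) :=
    mul_le_mul_of_nonneg_right (by linarith) (by positivity)
  linarith [R.noise_n, R.n_le j k]

/-- In the good regime every step before the level `θ` is reached is a good step. -/
lemma Regime.goodStep (R : F.Regime κ θ ρ S low0 low m0 τ τ' ν n0) (hτ' : 0 ≤ τ') (hν : 0 ≤ ν)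
    (t : ℕ) (hθ : ∀ u ≤ t, ∀ j, F.s u j < θ) :
    F.GoodStep κ t ∧ ∀ j i, |F.n t j i| ≤ ρ := by
  induction t using Nat.strong_induction_on with
  | _ t ih =>
    have hg : ∀ u < t, F.GoodStep κ u := fun u hu =>
      (ih u hu fun v hv => hθ v (hv.trans hu.le)).1
    have hn : ∀ u < t, ∀ j i, |F.n u j i| ≤ ρ := fun u hu =>
      (ih u hu fun v hv => hθ v (hv.trans hu.le)).2
    have hn' := R.noise_le_of_goodSteps hτ' hν hg hθ hn
    have hb := R.bounds_of_goodSteps hg (fun u hu => hθ u hu.le)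
    refine ⟨R.goodStep_of_bounds (fun j => ?_) (fun j => ?_) hn' (fun j => (hb j).2.1)
      (fun j => (hb j).2.2.2.2.1), hn'⟩
    · rw [abs_le]
      exact ⟨by linarith [(hb j).1, R.S_lt, R.S_pos], (hθ t le_rfl j).le⟩
    · rw [abs_le]
      exact ⟨by linarith [(hb j).2.2.2.1, R.S_pos], (hb j).2.2.2.2.2⟩

/-- The deterministic heart of the argument: at the first time `T` at which some neuron reaches
the level `θ` in the spurious direction, the core coordinates are still of initial size. -/
theorem Regime.exists_time (R : F.Regime κ θ ρ S low0 low m0 τ τ' ν n0)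
    (hτ' : 0 ≤ τ') (hν : 0 ≤ ν) :
    ∃ T : ℕ, 1 / (8 * F.η * F.βs ^ 3 * S) ≤ T ∧ F.η * T ≤ 8 / (κ * F.βs ^ 3 * m0) ∧
      (∀ t < T, F.GoodStep κ t) ∧ (∃ j, θ ≤ F.s T j) ∧ ∀ j, |F.c T j| ≤ 2 * S := by
  classical
  have hβs := R.βs_pos
  have hη := R.η_pos
  have hS := R.S_pos
  -- otherwise every step would be good, and good steps below `θ` last only for a bounded time
  have hex : ∃ T, ∃ j, θ ≤ F.s T j := by
    by_contra! hcon
    obtain ⟨t, ht⟩ := exists_nat_gt (8 / (κ * F.βs ^ 3 * m0) / F.η)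
    rw [div_lt_iff₀ hη] at ht
    have := R.time_le (t := t) (fun u _ => (R.goodStep hτ' hν u fun v _ => hcon v).1)
      (fun u _ => hcon u)
    linarith
  have hlt : ∀ u < Nat.find hex, ∀ j, F.s u j < θ := fun u hu j => by
    by_contra! h
    exact Nat.find_min hex hu ⟨j, h⟩
  have hg : ∀ u < Nat.find hex, F.GoodStep κ u := fun u hu =>
    (R.goodStep hτ' hν u fun v hv => hlt v (hv.trans_lt hu)).1
  have hb := R.bounds_of_goodSteps hg hlt
  refine ⟨Nat.find hex, ?_, R.time_le hg hlt, hg, Nat.find_spec hex, fun j => ?_⟩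
  · -- before that time no coordinate can have doubled its initial bound `S`, and `2 S < θ`
    obtain ⟨j, hj⟩ := Nat.find_spec hex
    by_contra! h
    rw [lt_div_iff₀ (by positivity)] at h
    have := (hb j).2.2.1 (by linarith)
    linarith [R.S_lt]
  · rw [abs_le]
    exact ⟨by linarith [(hb j).2.2.2.1, R.S_pos], (hb j).2.2.2.2.2⟩

end FeatureDynamics

end

/-! ### Gaussian tails and the data distribution -/

section

lemma stdNormal_tail {r : ℝ} (hr : 0 ≤ r) :
    gaussianReal 0 1 {g | r < |g|} ≤ ENNReal.ofReal (2 * Real.exp (-r ^ 2 / 2)) := by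
  have hmgf : ∀ t : ℝ, mgf id (gaussianReal 0 1) t = Real.exp (t ^ 2 / 2) := fun t => by
    rw [mgf_id_gaussianReal]; simp
  have h1 : (gaussianReal 0 1).real {g | r ≤ g} ≤ Real.exp (-r ^ 2 / 2) := by
    have := measure_ge_le_exp_mul_mgf (μ := gaussianReal 0 1) (X := id) r hr
      (integrable_exp_mul_gaussianReal r)
    rw [hmgf, ← Real.exp_add] at this
    exact this.trans (Real.exp_le_exp.2 (by linarith))
  have h2 : (gaussianReal 0 1).real {g | g ≤ -r} ≤ Real.exp (-r ^ 2 / 2) := by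
    have := measure_le_le_exp_mul_mgf (μ := gaussianReal 0 1) (X := id) (-r)
      (by linarith : -r ≤ 0) (integrable_exp_mul_gaussianReal (-r))
    rw [hmgf, ← Real.exp_add] at this
    exact this.trans (Real.exp_le_exp.2 (by linarith))
  have hsub : {g : ℝ | r < |g|} ⊆ {g | r ≤ g} ∪ {g | g ≤ -r} := fun g (hg : r < |g|) => by
    rcases lt_abs.1 hg with h | h
    · exact Or.inl h.le
    · exact Or.inr (by simp only [Set.mem_ofPred_eq]; linarith)
  rw [← ofReal_measureReal]
  refine ENNReal.ofReal_le_ofReal ((measureReal_mono hsub).trans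
    ((measureReal_union_le _ _).trans (by linarith)))

lemma stdNormal_small_ball (e : ℝ) :
    gaussianReal 0 1 {g | |g| ≤ e} ≤ ENNReal.ofReal (2 * e) := by
  have hset : {g : ℝ | |g| ≤ e} = Set.Icc (-e) e := by ext g; simp [abs_le]
  rw [gaussianReal_apply _ one_ne_zero, hset]
  have hpdf : ∀ x, gaussianPDF 0 1 x ≤ 1 := fun x => by
    rw [gaussianPDF, ENNReal.ofReal_le_one, gaussianPDFReal]
    have h1 : (√(2 * Real.pi * ((1 : NNReal) : ℝ)))⁻¹ ≤ 1 := by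
      apply inv_le_one_of_one_le₀
      rw [Real.one_le_sqrt]
      have := Real.pi_gt_three
      push_cast
      linarith
    have h2 : Real.exp (-(x - 0) ^ 2 / (2 * ((1 : NNReal) : ℝ))) ≤ 1 := by
      rw [Real.exp_le_one_iff]
      push_cast
      nlinarith [sq_nonneg (x - 0)]
    exact mul_le_one₀ h1 (Real.exp_pos _).le h2
  calc ∫⁻ x in Set.Icc (-e) e, gaussianPDF 0 1 x ≤ ∫⁻ _x in Set.Icc (-e) e, 1 :=
        lintegral_mono fun x => hpdf x
    _ = ENNReal.ofReal (2 * e) := by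
        rw [setLIntegral_one, Real.volume_Icc]; congr 1; ring

lemma stdNormal_lower_tail {x : ℝ} (hx : 0 ≤ x) :
    ENNReal.ofReal (Real.exp (-(x + 1) ^ 2 / 2) / 3) ≤ gaussianReal 0 1 {g | x ≤ g} := by
  have hsub : Set.Icc x (x + 1) ⊆ {g : ℝ | x ≤ g} := fun g hg => hg.1
  refine le_trans ?_ (measure_mono hsub)
  rw [gaussianReal_apply _ one_ne_zero]
  have hpdf : ∀ g ∈ Set.Icc x (x + 1),
      ENNReal.ofReal (Real.exp (-(x + 1) ^ 2 / 2) / 3) ≤ gaussianPDF 0 1 g := fun g hg => by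
    rw [gaussianPDF, gaussianPDFReal]
    apply ENNReal.ofReal_le_ofReal
    have h1 : (3 : ℝ)⁻¹ ≤ (√(2 * Real.pi * ((1 : NNReal) : ℝ)))⁻¹ := by
      have hp := Real.pi_gt_three
      apply inv_anti₀ (Real.sqrt_pos.2 (by push_cast; linarith))
      rw [Real.sqrt_le_left (by norm_num)]
      have := Real.pi_lt_four
      push_cast
      linarith
    have h2 : Real.exp (-(x + 1) ^ 2 / 2) ≤ Real.exp (-(g - 0) ^ 2 / (2 * ((1 : NNReal) : ℝ))) := by
      rw [Real.exp_le_exp]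
      push_cast
      have : g ^ 2 ≤ (x + 1) ^ 2 := pow_le_pow_left₀ (hx.trans hg.1) hg.2 2
      linarith
    rw [div_eq_inv_mul]
    exact mul_le_mul h1 h2 (Real.exp_pos _).le (by positivity)
  calc ENNReal.ofReal (Real.exp (-(x + 1) ^ 2 / 2) / 3)
      = ∫⁻ _g in Set.Icc x (x + 1), ENNReal.ofReal (Real.exp (-(x + 1) ^ 2 / 2) / 3) := by
        rw [setLIntegral_const, Real.volume_Icc]; simp
    _ ≤ ∫⁻ g in Set.Icc x (x + 1), gaussianPDF 0 1 g :=
        setLIntegral_mono (measurable_gaussianPDF 0 1) hpdf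

variable {d : ℕ}

instance isProbabilityMeasure_isoGaussian (s : ℝ) : IsProbabilityMeasure (isoGaussian d s) :=
  Measure.isProbabilityMeasure_map (by fun_prop)

/-- The one-dimensional marginals of `N(0, s² I_d)`. -/
lemma measure_isoGaussian_inner (s : ℝ) (v : Patch d) {A : Set ℝ} (hA : MeasurableSet A) :
    isoGaussian d s {w | inner ℝ w v ∈ A} = gaussianReal 0 1 {g | s * ‖v‖ * g ∈ A} := by
  have h1 : (stdGaussian (Patch d)).map (innerSL ℝ v) = gaussianReal 0 (‖v‖ ^ 2).toNNReal := by
    rw [IsGaussian.map_eq_gaussianReal, integral_strongDual_stdGaussian,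
      variance_dual_stdGaussian, innerSL_apply_norm]
  have h2 : (isoGaussian d s).map (fun w => inner ℝ w v) =
      (gaussianReal 0 1).map (fun g => s * ‖v‖ * g) := by
    have e1 : (isoGaussian d s).map (fun w => inner ℝ w v) =
        ((stdGaussian (Patch d)).map (innerSL ℝ v)).map (fun g => s * g) := by
      rw [isoGaussian, Measure.map_map (by fun_prop) (by fun_prop),
        Measure.map_map (by fun_prop) (by fun_prop)]
      congr 1
      ext w
      simp [real_inner_smul_right, real_inner_comm v]
    rw [e1, h1, gaussianReal_map_const_mul, gaussianReal_map_const_mul]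
    congr 1
    · simp
    · ext
      simp [mul_pow]
  have h3 := congrArg (fun μ => μ A) h2
  rwa [Measure.map_apply (by fun_prop) hA, Measure.map_apply (by fun_prop) hA] at h3

lemma isoGaussian_inner_tail {s r : ℝ} (hs : 0 ≤ s) (hr : 0 ≤ r) (v : Patch d) :
    isoGaussian d s {w | r * s * ‖v‖ < |inner ℝ w v|} ≤
      ENNReal.ofReal (2 * Real.exp (-r ^ 2 / 2)) := by
  have hA : MeasurableSet {x : ℝ | r * s * ‖v‖ < |x|} :=
    measurableSet_lt measurable_const (by fun_prop)
  refine (measure_isoGaussian_inner s v hA).le.trans (le_trans (measure_mono fun g hg => ?_)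
    (stdNormal_tail hr))
  simp only [Set.mem_ofPred_eq] at hg ⊢
  rw [abs_mul, abs_of_nonneg (by positivity : 0 ≤ s * ‖v‖)] at hg
  by_contra! h
  have := mul_le_mul_of_nonneg_left h (by positivity : 0 ≤ s * ‖v‖)
  linarith

/-- An isotropic Gaussian is nearly orthogonal to any independent random vector. -/
lemma prod_isoGaussian_inner_tail {X : Type*} [MeasurableSpace X] (μ : Measure X)
    [IsProbabilityMeasure μ] {f : X → Patch d} (hf : Measurable f) {s r : ℝ} (hs : 0 ≤ s)
    (hr : 0 ≤ r) :
    (μ.prod (isoGaussian d s)) {p | r * s * ‖f p.1‖ < |inner ℝ p.2 (f p.1)|} ≤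
      ENNReal.ofReal (2 * Real.exp (-r ^ 2 / 2)) := by
  have hmeas : MeasurableSet {p : X × Patch d | r * s * ‖f p.1‖ < |inner ℝ p.2 (f p.1)|} := by
    have : Measurable fun p : X × Patch d => inner ℝ p.2 (f p.1) :=
      measurable_snd.inner (hf.comp measurable_fst)
    exact measurableSet_lt (by fun_prop) this.abs
  rw [Measure.prod_apply hmeas]
  calc ∫⁻ x, isoGaussian d s (Prod.mk x ⁻¹'
        {p : X × Patch d | r * s * ‖f p.1‖ < |inner ℝ p.2 (f p.1)|}) ∂μ
      ≤ ∫⁻ _x, ENNReal.ofReal (2 * Real.exp (-r ^ 2 / 2)) ∂μ :=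
        lintegral_mono fun x => isoGaussian_inner_tail hs hr (f x)
    _ = _ := by simp

lemma isoGaussian_inner_small_ball {s e : ℝ} (hs : 0 < s) {v : Patch d}
    (hv : ‖v‖ = 1) :
    isoGaussian d s {w | |inner ℝ w v| ≤ s * e} ≤ ENNReal.ofReal (2 * e) := by
  have hA : MeasurableSet {x : ℝ | |x| ≤ s * e} :=
    measurableSet_le (by fun_prop) measurable_const
  refine (measure_isoGaussian_inner s v hA).le.trans (le_trans (measure_mono fun g hg => ?_)
    (stdNormal_small_ball e))
  simp only [Set.mem_ofPred_eq] at hg ⊢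
  rw [hv, mul_one, abs_mul, abs_of_pos hs] at hg
  exact le_of_mul_le_mul_left hg hs

/-- Among many independent Gaussian vectors, one has a large coordinate in a given direction. -/
lemma pi_isoGaussian_forall_inner_lt_le {s x : ℝ} (hs : 0 < s) (hx : 0 ≤ x) {v : Patch d} (hv : ‖v‖ = 1)
    (J : ℕ) :
    (Measure.pi fun _ : Fin J => isoGaussian d s) {w | ∀ j, inner ℝ (w j) v < s * x} ≤
      ENNReal.ofReal (Real.exp (-(J * (Real.exp (-(x + 1) ^ 2 / 2) / 3)))) := by
  set p := Real.exp (-(x + 1) ^ 2 / 2) / 3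
  have hset : {w : Fin J → Patch d | ∀ j, inner ℝ (w j) v < s * x} =
      Set.univ.pi fun _ => {w | inner ℝ w v ∈ Set.Iio (s * x)} := by ext; simp
  have hg : {g : ℝ | s * ‖v‖ * g ∈ Set.Iio (s * x)} = (Set.Ici x)ᶜ := by
    ext g
    simp [hv, hs]
  have h1 : gaussianReal 0 1 (Set.Ici x)ᶜ ≤ ENNReal.ofReal (Real.exp (-p)) := by
    rw [prob_compl_eq_one_sub measurableSet_Ici, tsub_le_iff_right]
    refine le_trans ?_ (add_le_add_right (stdNormal_lower_tail hx) _)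
    rw [← ENNReal.ofReal_add (Real.exp_pos _).le (by positivity), ENNReal.one_le_ofReal]
    have := Real.add_one_le_exp (-p)
    simp only [p] at *
    linarith
  rw [hset, Measure.pi_pi]
  simp only [measure_isoGaussian_inner s v measurableSet_Iio, hg, Finset.prod_const,
    Finset.card_univ, Fintype.card_fin]
  refine (pow_le_pow_left' h1 J).trans ?_
  rw [← ENNReal.ofReal_pow (Real.exp_pos _).le, ← Real.exp_nat_mul]
  apply le_of_eq
  congr 2
  ring

lemma isProbabilityMeasure_signLaw {q : ℝ} (h0 : 0 ≤ q) (h1 : q ≤ 1) :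
    IsProbabilityMeasure (signLaw q) := ⟨by
  simp [signLaw, ← ENNReal.ofReal_add h0 (sub_nonneg.2 h1)]⟩

lemma ae_signLaw (q : ℝ) : ∀ᵐ x ∂(signLaw q), |x| = 1 := by
  have hm : MeasurableSet {x : ℝ | |x| = 1} :=
    (measurableSet_singleton (1 : ℝ)).preimage (by fun_prop : Measurable fun x : ℝ => |x|)
  rw [signLaw, ae_add_measure_iff]
  constructor <;> refine Measure.ae_smul_measure ?_ _ <;> rw [ae_dirac_iff hm] <;> simp

lemma integral_signLaw {q : ℝ} (h0 : 0 ≤ q) (h1 : q ≤ 1) : ∫ x, x ∂(signLaw q) = 2 * q - 1 := by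
  rw [signLaw, integral_add_measure, integral_smul_measure, integral_smul_measure,
    integral_dirac, integral_dirac, ENNReal.toReal_ofReal h0,
    ENNReal.toReal_ofReal (by linarith)]
  · simp; ring
  all_goals exact (integrable_dirac (by simp)).smul_measure ENNReal.ofReal_ne_top

namespace DataModel

variable (D : DataModel d) {α σp : ℝ}

lemma isProbabilityMeasure_seedLaw (h0 : 0 ≤ α) (h1 : α ≤ 1) :
    IsProbabilityMeasure (D.seedLaw α σp) := by
  have := isProbabilityMeasure_signLaw D.q_nonneg D.q_le_one
  have := isProbabilityMeasure_signLaw h0 h1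
  have := D.order_prob
  unfold seedLaw
  infer_instance

lemma measurePreserving_label (h0 : 0 ≤ α) (h1 : α ≤ 1) :
    MeasurePreserving (fun z : Seed d => z.1) (D.seedLaw α σp) (signLaw D.q) := by
  have := isProbabilityMeasure_signLaw D.q_nonneg D.q_le_one
  have := isProbabilityMeasure_signLaw h0 h1
  have := D.order_prob
  exact measurePreserving_fst

lemma measurePreserving_sign (h0 : 0 ≤ α) (h1 : α ≤ 1) :
    MeasurePreserving (fun z : Seed d => z.2.1) (D.seedLaw α σp) (signLaw α) := by
  have := isProbabilityMeasure_signLaw D.q_nonneg D.q_le_one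
  have := isProbabilityMeasure_signLaw h0 h1
  have := D.order_prob
  exact measurePreserving_fst.comp measurePreserving_snd

lemma measurePreserving_noise (h0 : 0 ≤ α) (h1 : α ≤ 1) :
    MeasurePreserving (fun z : Seed d => z.2.2.2) (D.seedLaw α σp)
      (isoGaussian d (σp / √d)) := by
  have := isProbabilityMeasure_signLaw D.q_nonneg D.q_le_one
  have := isProbabilityMeasure_signLaw h0 h1
  have := D.order_prob
  exact measurePreserving_snd.comp (measurePreserving_snd.comp measurePreserving_snd)

/-- The majority of the signs `b_i` concentrates around its mean (Chebyshev). -/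
lemma sum_sign_concentration (h0 : 0 ≤ α) (h1 : α ≤ 1) (hα : 0 < 2 * α - 1) {N : ℕ}
    (hN : 0 < N) :
    (Measure.pi fun _ : Fin N => D.seedLaw α σp)
      {z | ∑ i, (z i).2.1 < (2 * α - 1) / 2 * N} ≤
      ENNReal.ofReal (4 / ((2 * α - 1) ^ 2 * N)) := by
  have := D.isProbabilityMeasure_seedLaw (σp := σp) h0 h1
  have := isProbabilityMeasure_signLaw h0 h1
  have hN' : (0 : ℝ) < N := by exact_mod_cast hN
  have hmp := D.measurePreserving_sign (σp := σp) h0 h1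
  have hb : MemLp (fun x : ℝ => x) 2 (signLaw α) :=
    MemLp.of_bound (by fun_prop) 1 ((ae_signLaw α).mono fun x hx => by simp [hx])
  have hX : MemLp (fun z : Seed d => z.2.1) 2 (D.seedLaw α σp) :=
    hb.comp_measurePreserving hmp
  have hmean : ∫ z : Seed d, z.2.1 ∂(D.seedLaw α σp) = 2 * α - 1 := by
    rw [← integral_signLaw h0 h1, ← hmp.map_eq, integral_map (by fun_prop) (by fun_prop)]
  have hvar : Var[fun z : Seed d => z.2.1; D.seedLaw α σp] ≤ 1 := by
    refine (variance_le_expectation_sq hX.1).trans ?_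
    have : ∫ z : Seed d, z.2.1 ^ 2 ∂(D.seedLaw α σp) = 1 := by
      have hae : (fun z : Seed d => z.2.1 ^ 2) =ᵐ[D.seedLaw α σp] fun _ => 1 := by
        have := hmp.quasiMeasurePreserving.ae (ae_signLaw α)
        filter_upwards [this] with z hz
        rw [← sq_abs, hz, one_pow]
      rw [integral_congr_ae hae]; simp
    exact this.le
  have hsum : MemLp (∑ i : Fin N, fun z : Fin N → Seed d => (z i).2.1) 2
      (Measure.pi fun _ : Fin N => D.seedLaw α σp) :=
    memLp_finsetSum' _ fun i _ => hX.comp_measurePreserving (measurePreserving_eval _ i)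
  have hE : ∫ z, (∑ i : Fin N, fun z : Fin N → Seed d => (z i).2.1) z
      ∂(Measure.pi fun _ : Fin N => D.seedLaw α σp) = N * (2 * α - 1) := by
    simp only [Finset.sum_apply]
    rw [integral_finsetSum]
    · have : ∀ i : Fin N, ∫ z : Fin N → Seed d, (z i).2.1
          ∂(Measure.pi fun _ : Fin N => D.seedLaw α σp) = 2 * α - 1 := fun i => by
        rw [← hmean]
        exact integral_comp_eval (μ := fun _ : Fin N => D.seedLaw α σp) (i := i) hX.1
      simp only [this, Finset.sum_const, Finset.card_univ, Fintype.card_fin, nsmul_eq_mul]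
    · exact fun i _ => (hX.comp_measurePreserving (measurePreserving_eval _ i)).integrable
        one_le_two
  have hV : Var[∑ i : Fin N, fun z : Fin N → Seed d => (z i).2.1;
      Measure.pi fun _ : Fin N => D.seedLaw α σp] ≤ N := by
    rw [variance_sum_pi (X := fun _ (z : Seed d) => z.2.1) (fun _ => hX)]
    simpa using Finset.sum_le_sum fun (i : Fin N) (_ : i ∈ Finset.univ) => hvar
  have hc : 0 < (2 * α - 1) / 2 * N := by positivity
  have key := meas_ge_le_variance_div_sq hsum hc
  refine (measure_mono fun z hz => ?_).trans (key.trans (ENNReal.ofReal_le_ofReal ?_))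
  · simp only [Set.mem_ofPred_eq] at hz ⊢
    rw [hE, Finset.sum_apply, abs_sub_comm]
    exact le_trans (by linarith) (le_abs_self _)
  · calc _ ≤ (N : ℝ) / ((2 * α - 1) / 2 * N) ^ 2 := by gcongr
      _ = _ := by field_simp; norm_num

end DataModel

end

/-! ### Probability of a good draw -/

section

variable {d : ℕ}

/-- The properties of the training set and the initialization that the deterministic analysis
uses. `κ` is the majority margin, `r` the width of the Gaussian tails for the noise, and `x`, `e`,
`xm` bound the initial feature correlations in units of `σ0` from above, away from zero, and (for
the best neuron) from below. -/
structure DataModel.GoodDraw (D : DataModel d) {N J : ℕ} (κ σp σ0 r x e xm : ℝ)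
    (ω : (Fin N → Seed d) × (Fin J → Patch d)) : Prop where
  label : ∀ i, |(ω.1 i).1| = 1
  sign : ∀ i, |(ω.1 i).2.1| = 1
  majority : κ / 2 * N ≤ ∑ i, (ω.1 i).2.1
  noise_vs : ∀ i, |inner ℝ (ω.1 i).2.2.2 D.vs| ≤ r * (σp / √d)
  noise_vc : ∀ i, |inner ℝ (ω.1 i).2.2.2 D.vc| ≤ r * (σp / √d)
  noise_norm : ∀ i, ‖(ω.1 i).2.2.2‖ ≤ r * σp
  noise_pair : ∀ i k, i ≠ k →
    |inner ℝ (ω.1 i).2.2.2 (ω.1 k).2.2.2| ≤ r * (σp / √d) * ‖(ω.1 k).2.2.2‖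
  init_noise : ∀ j i, |inner ℝ (ω.2 j) (ω.1 i).2.2.2| ≤ r * σ0 * ‖(ω.1 i).2.2.2‖
  init_vs_le : ∀ j, |inner ℝ (ω.2 j) D.vs| ≤ x * σ0
  init_vc_le : ∀ j, |inner ℝ (ω.2 j) D.vc| ≤ x * σ0
  init_vs_ge : ∀ j, σ0 * e ≤ |inner ℝ (ω.2 j) D.vs|
  init_vc_ge : ∀ j, σ0 * e ≤ |inner ℝ (ω.2 j) D.vc|
  init_max : ∃ j, σ0 * xm ≤ inner ℝ (ω.2 j) D.vs

lemma measure_exists_le {Ω ι : Type*} [MeasurableSpace Ω] [Fintype ι] (μ : Measure Ω)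
    (A : ι → Set Ω) {c : ℝ} (h : ∀ i, μ (A i) ≤ ENNReal.ofReal c) :
    μ {ω | ∃ i, ω ∈ A i} ≤ ENNReal.ofReal (Fintype.card ι * c) := by
  have hset : {ω | ∃ i, ω ∈ A i} = ⋃ i, A i := by ext; simp
  rw [hset]
  calc μ (⋃ i, A i) ≤ ∑ i, μ (A i) := measure_iUnion_fintype_le μ A
    _ ≤ ∑ _i : ι, ENNReal.ofReal c := Finset.sum_le_sum fun i _ => h i
    _ = _ := by
      rw [ENNReal.ofReal_mul (by positivity)]
      simp

lemma measure_union_le_ofReal {Ω : Type*} [MeasurableSpace Ω] {μ : Measure Ω} {A B : Set Ω}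
    {a b : ℝ} (ha : 0 ≤ a) (hb : 0 ≤ b) (hA : μ A ≤ ENNReal.ofReal a)
    (hB : μ B ≤ ENNReal.ofReal b) : μ (A ∪ B) ≤ ENNReal.ofReal (a + b) := by
  rw [ENNReal.ofReal_add ha hb]
  exact (measure_union_le A B).trans (add_le_add hA hB)

lemma measure_preimage_le_of_measurePreserving {Ω X : Type*} [MeasurableSpace Ω]
    [MeasurableSpace X] {μ : Measure Ω} {ν : Measure X} {f : Ω → X}
    (hf : MeasurePreserving f μ ν) {s : Set X} {c : ENNReal} (h : ν s ≤ c) :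
    μ (f ⁻¹' s) ≤ c := by
  refine (Measure.le_map_apply hf.measurable.aemeasurable s).trans ?_
  rwa [hf.map_eq]

/-- Two different coordinates of an i.i.d. family have the product law. -/
lemma measurePreserving_pair {X : Type*} [MeasurableSpace X] (μ : Measure X)
    [IsProbabilityMeasure μ] {N : ℕ} {i k : Fin N} (hik : i ≠ k) :
    MeasurePreserving (fun z : Fin N → X => (z i, z k)) (Measure.pi fun _ => μ) (μ.prod μ) := by
  refine ⟨by fun_prop, ?_⟩
  have h := (iIndepFun_pi (μ := fun _ : Fin N => μ) (X := fun _ => id)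
    (fun _ => aemeasurable_id)).indepFun hik
  have h2 := h.map_prod_eq_prod_map_map (measurable_pi_apply i).aemeasurable
    (measurable_pi_apply k).aemeasurable
  have e : ∀ i : Fin N, (Measure.pi fun _ : Fin N => μ).map (fun z => z i) = μ := fun i =>
    (measurePreserving_eval (fun _ : Fin N => μ) i).map_eq
  rw [e, e] at h2
  exact h2

namespace DataModel

variable (D : DataModel d) {α σp σ0 : ℝ} {N J : ℕ}

lemma measurePreserving_data (h0 : 0 ≤ α) (h1 : α ≤ 1) (i : Fin N) :
    MeasurePreserving (fun ω : (Fin N → Seed d) × (Fin J → Patch d) => ω.1 i)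
      (D.jointLaw α σp σ0 N J) (D.seedLaw α σp) := by
  have := D.isProbabilityMeasure_seedLaw (σp := σp) h0 h1
  exact (measurePreserving_eval (fun _ : Fin N => D.seedLaw α σp) i).comp measurePreserving_fst

lemma measurePreserving_dataset (h0 : 0 ≤ α) (h1 : α ≤ 1) :
    MeasurePreserving (fun ω : (Fin N → Seed d) × (Fin J → Patch d) => ω.1)
      (D.jointLaw α σp σ0 N J) (Measure.pi fun _ => D.seedLaw α σp) := by
  have := D.isProbabilityMeasure_seedLaw (σp := σp) h0 h1
  exact measurePreserving_fst

lemma measurePreserving_init (h0 : 0 ≤ α) (h1 : α ≤ 1) :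
    MeasurePreserving (fun ω : (Fin N → Seed d) × (Fin J → Patch d) => ω.2)
      (D.jointLaw α σp σ0 N J) (Measure.pi fun _ => isoGaussian d σ0) := by
  have := D.isProbabilityMeasure_seedLaw (σp := σp) h0 h1
  exact measurePreserving_snd

lemma measurePreserving_neuron (h0 : 0 ≤ α) (h1 : α ≤ 1) (j : Fin J) :
    MeasurePreserving (fun ω : (Fin N → Seed d) × (Fin J → Patch d) => ω.2 j)
      (D.jointLaw α σp σ0 N J) (isoGaussian d σ0) :=
  (measurePreserving_eval (fun _ : Fin J => isoGaussian d σ0) j).comp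
    (D.measurePreserving_init h0 h1)

lemma measurePreserving_noise_neuron (h0 : 0 ≤ α) (h1 : α ≤ 1) (i : Fin N) (j : Fin J) :
    MeasurePreserving
      (fun ω : (Fin N → Seed d) × (Fin J → Patch d) => ((ω.1 i).2.2.2, ω.2 j))
      (D.jointLaw α σp σ0 N J) ((isoGaussian d (σp / √d)).prod (isoGaussian d σ0)) := by
  have := D.isProbabilityMeasure_seedLaw (σp := σp) h0 h1
  exact MeasurePreserving.prod ((D.measurePreserving_noise h0 h1).comp
    (measurePreserving_eval (fun _ : Fin N => D.seedLaw α σp) i))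
    (measurePreserving_eval (fun _ : Fin J => isoGaussian d σ0) j)

lemma measurePreserving_noise_pair (h0 : 0 ≤ α) (h1 : α ≤ 1) {i k : Fin N} (hik : i ≠ k) :
    MeasurePreserving
      (fun ω : (Fin N → Seed d) × (Fin J → Patch d) => ((ω.1 k).2.2.2, (ω.1 i).2.2.2))
      (D.jointLaw α σp σ0 N J)
      ((isoGaussian d (σp / √d)).prod (isoGaussian d (σp / √d))) := by
  have := D.isProbabilityMeasure_seedLaw (σp := σp) h0 h1
  exact (MeasurePreserving.prod (D.measurePreserving_noise (σp := σp) h0 h1)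
    (D.measurePreserving_noise h0 h1)).comp
    ((measurePreserving_pair (D.seedLaw α σp) hik.symm).comp (D.measurePreserving_dataset h0 h1))

/-- A vector all of whose coordinates are at most `B / √d` has norm at most `B`. -/
lemma norm_le_of_coord_le {B : ℝ} (hB : 0 ≤ B) (v : Patch d)
    (h : ∀ l, |inner ℝ v (EuclideanSpace.single l (1 : ℝ))| ≤ B / √d) : ‖v‖ ≤ B := by
  rw [EuclideanSpace.norm_eq]
  refine Real.sqrt_le_iff.2 ⟨hB, ?_⟩
  rcases Nat.eq_zero_or_pos d with rfl | hd
  · simpa using sq_nonneg B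
  have hd' : (0 : ℝ) < d := by exact_mod_cast hd
  calc ∑ l, ‖v l‖ ^ 2 ≤ ∑ _l : Fin d, B ^ 2 / d := Finset.sum_le_sum fun l _ => by
        have h1 : ‖v l‖ ≤ B / √d := by
          have := h l
          rw [EuclideanSpace.inner_single_right] at this
          simpa using this
        calc ‖v l‖ ^ 2 ≤ (B / √d) ^ 2 := pow_le_pow_left₀ (norm_nonneg _) h1 2
          _ = B ^ 2 / d := by rw [div_pow, Real.sq_sqrt hd'.le]
    _ = B ^ 2 := by
        simp only [Finset.sum_const, Finset.card_univ, Fintype.card_fin, nsmul_eq_mul]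
        field_simp

variable {κ r x e xm : ℝ}

lemma measure_noise_inner_tail (hα0 : 0 ≤ α) (hα1 : α ≤ 1) (hσp : 0 < σp) (hr : 0 ≤ r)
    {v : Patch d} (hv : ‖v‖ = 1) (i : Fin N) :
    D.jointLaw α σp σ0 N J {ω | r * (σp / √d) < |inner ℝ (ω.1 i).2.2.2 v|} ≤
      ENNReal.ofReal (2 * Real.exp (-r ^ 2 / 2)) := by
  have h := isoGaussian_inner_tail (s := σp / √d) (by positivity) hr v
  rw [hv, mul_one] at h
  exact measure_preimage_le_of_measurePreserving
    ((D.measurePreserving_noise hα0 hα1).comp (D.measurePreserving_data hα0 hα1 i)) h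

/-- Union bound for the failure of any of the properties of a good draw. The norm of a noise patch
is controlled through its `d` coordinates, which costs a harmless factor `r` over the true size. -/
theorem measure_not_goodDraw_le (hα : 1 / 2 < α) (hα1 : α ≤ 1) (hσp : 0 < σp) (hσ0 : 0 < σ0)
    (hr : 0 ≤ r) (hx : 0 ≤ x) (he : 0 ≤ e) (hxm : 0 ≤ xm) (hN : 0 < N) :
    D.jointLaw α σp σ0 N J {ω | ¬ D.GoodDraw (2 * α - 1) σp σ0 r x e xm ω} ≤
      ENNReal.ofReal (4 / ((2 * α - 1) ^ 2 * N)
        + N * (2 + d + N + J) * (2 * Real.exp (-r ^ 2 / 2))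
        + J * (4 * Real.exp (-x ^ 2 / 2)) + J * (4 * e)
        + Real.exp (-(J * (Real.exp (-(xm + 1) ^ 2 / 2) / 3)))) := by
  have hα0 : 0 ≤ α := by linarith
  set μ := D.jointLaw α σp σ0 N J
  set G := 2 * Real.exp (-r ^ 2 / 2) with hG
  have hG0 : 0 ≤ G := by positivity
  have b1 : μ {ω | ∃ i, ω ∈ {ω | ¬ |(ω.1 i).1| = 1}} ≤ ENNReal.ofReal (Fintype.card (Fin N) * 0) :=
    measure_exists_le μ _ fun i => by
      have := ((D.measurePreserving_label hα0 hα1).comp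
        (D.measurePreserving_data (σp := σp) (σ0 := σ0) (J := J) hα0 hα1 i)).quasiMeasurePreserving.ae
        (ae_signLaw D.q)
      rw [ENNReal.ofReal_zero]
      exact (ae_iff.1 this).le
  have b2 : μ {ω | ∃ i, ω ∈ {ω | ¬ |(ω.1 i).2.1| = 1}} ≤
      ENNReal.ofReal (Fintype.card (Fin N) * 0) :=
    measure_exists_le μ _ fun i => by
      have := ((D.measurePreserving_sign hα0 hα1).comp
        (D.measurePreserving_data (σp := σp) (σ0 := σ0) (J := J) hα0 hα1 i)).quasiMeasurePreserving.ae
        (ae_signLaw α)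
      rw [ENNReal.ofReal_zero]
      exact (ae_iff.1 this).le
  have b3 : μ {ω | ∑ i, (ω.1 i).2.1 < (2 * α - 1) / 2 * N} ≤
      ENNReal.ofReal (4 / ((2 * α - 1) ^ 2 * N)) :=
    measure_preimage_le_of_measurePreserving (D.measurePreserving_dataset hα0 hα1)
      (D.sum_sign_concentration hα0 hα1 (by linarith) hN)
  have b4 : μ {ω | ∃ i, ω ∈ {ω | r * (σp / √d) < |inner ℝ (ω.1 i).2.2.2 D.vs|}} ≤
      ENNReal.ofReal (Fintype.card (Fin N) * G) :=
    measure_exists_le μ _ fun i => D.measure_noise_inner_tail hα0 hα1 hσp hr D.norm_vs i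
  have b5 : μ {ω | ∃ i, ω ∈ {ω | r * (σp / √d) < |inner ℝ (ω.1 i).2.2.2 D.vc|}} ≤
      ENNReal.ofReal (Fintype.card (Fin N) * G) :=
    measure_exists_le μ _ fun i => D.measure_noise_inner_tail hα0 hα1 hσp hr D.norm_vc i
  have b6 : μ {ω | ∃ p : Fin N × Fin d, ω ∈ {ω | r * (σp / √d) <
      |inner ℝ (ω.1 p.1).2.2.2 (EuclideanSpace.single p.2 (1 : ℝ))|}} ≤
      ENNReal.ofReal (Fintype.card (Fin N × Fin d) * G) :=
    measure_exists_le μ _ fun p =>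
      D.measure_noise_inner_tail hα0 hα1 hσp hr (by simp) p.1
  have b7 : μ {ω | ∃ p : Fin N × Fin N, ω ∈ {ω | p.1 ≠ p.2 ∧ r * (σp / √d) *
      ‖(ω.1 p.2).2.2.2‖ < |inner ℝ (ω.1 p.1).2.2.2 (ω.1 p.2).2.2.2|}} ≤
      ENNReal.ofReal (Fintype.card (Fin N × Fin N) * G) :=
    measure_exists_le μ _ fun p => by
      by_cases hp : p.1 = p.2
      · simp [hp]
      · simp only [ne_eq, hp, not_false_eq_true, true_and]
        exact measure_preimage_le_of_measurePreserving (D.measurePreserving_noise_pair hα0 hα1 hp)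
          (prod_isoGaussian_inner_tail _ measurable_id (by positivity) hr)
  have b8 : μ {ω | ∃ p : Fin N × Fin J, ω ∈ {ω | r * σ0 * ‖(ω.1 p.1).2.2.2‖ <
      |inner ℝ (ω.2 p.2) (ω.1 p.1).2.2.2|}} ≤
      ENNReal.ofReal (Fintype.card (Fin N × Fin J) * G) :=
    measure_exists_le μ _ fun p =>
      measure_preimage_le_of_measurePreserving
        (D.measurePreserving_noise_neuron hα0 hα1 p.1 p.2)
        (prod_isoGaussian_inner_tail _ measurable_id hσ0.le hr)
  have b9 : ∀ v : Patch d, ‖v‖ = 1 → μ {ω | ∃ j, ω ∈ {ω | x * σ0 < |inner ℝ (ω.2 j) v|}} ≤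
      ENNReal.ofReal (Fintype.card (Fin J) * (2 * Real.exp (-x ^ 2 / 2))) := fun v hv =>
    measure_exists_le μ _ fun j => by
      have h := isoGaussian_inner_tail hσ0.le hx v
      rw [hv, mul_one] at h
      exact measure_preimage_le_of_measurePreserving (D.measurePreserving_neuron hα0 hα1 j) h
  have b10 : ∀ v : Patch d, ‖v‖ = 1 → μ {ω | ∃ j, ω ∈ {ω | |inner ℝ (ω.2 j) v| ≤ σ0 * e}} ≤
      ENNReal.ofReal (Fintype.card (Fin J) * (2 * e)) := fun v hv =>
    measure_exists_le μ _ fun j =>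
      measure_preimage_le_of_measurePreserving (D.measurePreserving_neuron hα0 hα1 j)
        (isoGaussian_inner_small_ball hσ0 hv)
  have b11 : μ {ω | ∀ j, inner ℝ (ω.2 j) D.vs < σ0 * xm} ≤
      ENNReal.ofReal (Real.exp (-(J * (Real.exp (-(xm + 1) ^ 2 / 2) / 3)))) :=
    measure_preimage_le_of_measurePreserving (D.measurePreserving_init hα0 hα1)
      (pi_isoGaussian_forall_inner_lt_le hσ0 hxm D.norm_vs J)
  have hκ : 0 < 2 * α - 1 := by linarith
  have u := measure_union_le_ofReal (by positivity) (by positivity) b1 b2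
  have u := measure_union_le_ofReal (by positivity) (by positivity) u b3
  have u := measure_union_le_ofReal (by positivity) (by positivity) u b4
  have u := measure_union_le_ofReal (by positivity) (by positivity) u b5
  have u := measure_union_le_ofReal (by positivity) (by positivity) u b6
  have u := measure_union_le_ofReal (by positivity) (by positivity) u b7
  have u := measure_union_le_ofReal (by positivity) (by positivity) u b8
  have u := measure_union_le_ofReal (by positivity) (by positivity) u (b9 _ D.norm_vs)
  have u := measure_union_le_ofReal (by positivity) (by positivity) u (b9 _ D.norm_vc)
  have u := measure_union_le_ofReal (by positivity) (by positivity) u (b10 _ D.norm_vs)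
  have u := measure_union_le_ofReal (by positivity) (by positivity) u (b10 _ D.norm_vc)
  have u := measure_union_le_ofReal (by positivity) (by positivity) u b11
  refine (measure_mono fun ω hω => ?_).trans (u.trans (le_of_eq ?_))
  · by_contra hc
    simp only [Set.mem_union, not_or] at hc
    obtain ⟨⟨⟨⟨⟨⟨⟨⟨⟨⟨⟨⟨c1, c2⟩, c3⟩, c4⟩, c5⟩, c6⟩, c7⟩, c8⟩, c9⟩, c9'⟩, c10⟩, c10'⟩, c11⟩ := hc
    simp only [Set.mem_ofPred_eq, not_exists, not_lt, not_le, not_not, not_forall, not_and]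
      at c1 c2 c3 c4 c5 c6 c7 c8 c9 c9' c10 c10' c11
    exact hω
      { label := c1
        sign := c2
        majority := c3
        noise_vs := c4
        noise_vc := c5
        noise_norm := fun i => norm_le_of_coord_le (by positivity) _ fun l => by
          rw [mul_div_assoc]
          exact c6 (i, l)
        noise_pair := fun i k hik => c7 (i, k) hik
        init_noise := fun j i => c8 (i, j)
        init_vs_le := c9
        init_vc_le := c9'
        init_vs_ge := fun j => (c10 j).le
        init_vc_ge := fun j => (c10' j).le
        init_max := c11 }
  · congr 1
    simp only [Fintype.card_prod, Fintype.card_fin]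
    push_cast
    ring

end DataModel

end

/-! ### From a good draw to the feature dynamics -/

section

variable {d : ℕ}

/-- The feature dynamics of gradient descent for the random choices `ω`. -/
noncomputable def DataModel.dynamics (D : DataModel d) {N J : ℕ} (η : ℝ)
    (ω : (Fin N → Seed d) × (Fin J → Patch d)) (hy : ∀ i, |(ω.1 i).1| = 1)
    (hb : ∀ i, |(ω.1 i).2.1| = 1) : FeatureDynamics N J :=
  have hy2 : ∀ i, (ω.1 i).1 ^ 2 = 1 := fun i => by rw [← sq_abs, hy, one_pow]
  have hb2 : ∀ i, (ω.1 i).2.1 ^ 2 = 1 := fun i => by rw [← sq_abs, hb, one_pow]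
  have hcs : inner ℝ D.vs D.vc = 0 := by rw [real_inner_comm]; exact D.inner_vc_vs
  have hcc : inner ℝ D.vc D.vc = 1 := by
    rw [real_inner_self_eq_norm_sq, D.norm_vc, one_pow]
  have hss : inner ℝ D.vs D.vs = 1 := by
    rw [real_inner_self_eq_norm_sq, D.norm_vs, one_pow]
  { η := η
    βc := D.βc
    βs := D.βs
    y := fun i => (ω.1 i).1
    b := fun i => (ω.1 i).2.1
    us := fun i => inner ℝ (ω.1 i).2.2.2 D.vs
    uc := fun i => inner ℝ (ω.1 i).2.2.2 D.vc
    g := fun i k => inner ℝ (ω.1 i).2.2.2 (ω.1 k).2.2.2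
    s := fun t j => inner ℝ (D.neuron η ω t j) D.vs
    c := fun t j => inner ℝ (D.neuron η ω t j) D.vc
    n := fun t j i => inner ℝ (D.neuron η ω t j) (ω.1 i).2.2.2
    l := fun t i => logisticWeight ((D.dataset ω.1 i).y *
      cnn (gd (D.dataset ω.1) η (WithLp.toLp 2 ω.2) t) (D.dataset ω.1 i).x)
    l_eq := fun t i => by
      rw [DataModel.dataset, D.margin_eq _ (hy2 i) (hb2 i)]
      rfl
    s_succ := fun t j => by
      unfold DataModel.neuron
      rw [inner_gd_succ]
      congr 2
      refine Finset.sum_congr rfl fun i _ => ?_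
      simp only [DataModel.dataset]
      rw [D.gradient_term_eq _ (hy2 i) (hb2 i), D.inner_vc_vs, hss]
      ring
    c_succ := fun t j => by
      unfold DataModel.neuron
      rw [inner_gd_succ]
      congr 2
      refine Finset.sum_congr rfl fun i _ => ?_
      simp only [DataModel.dataset]
      rw [D.gradient_term_eq _ (hy2 i) (hb2 i), hcs, hcc]
      ring
    n_succ := fun t j k => by
      unfold DataModel.neuron
      rw [inner_gd_succ]
      congr 2
      refine Finset.sum_congr rfl fun i _ => ?_
      simp only [DataModel.dataset]
      rw [D.gradient_term_eq _ (hy2 i) (hb2 i), real_inner_comm _ D.vc, real_inner_comm _ D.vs] }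

/-- The majority margin `2 α̂ - 1` is the mean of the signs `b_i`. -/
lemma DataModel.two_mul_groupProportion_sub_one (D : DataModel d) {N : ℕ} (hN : 0 < N)
    (z : Fin N → Seed d) (hy : ∀ i, |(z i).1| = 1) (hb : ∀ i, |(z i).2.1| = 1) :
    2 * groupProportion (D.dataset z) - 1 = (∑ i, (z i).2.1) / N := by
  classical
  have hN' : (0 : ℝ) < N := by exact_mod_cast hN
  have hiff : ∀ i, (D.dataset z i).a = (D.dataset z i).y ↔ (z i).2.1 = 1 := fun i => by
    have h0 : (z i).1 ≠ 0 := fun h => by simpa [h] using hy i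
    simp only [DataModel.dataset, DataModel.dataPoint]
    exact ⟨fun h => mul_right_cancel₀ h0 (by rw [h, one_mul]), fun h => by rw [h, one_mul]⟩
  have hsum : ∑ i, (z i).2.1 = ∑ i, (2 * (if (z i).2.1 = 1 then (1 : ℝ) else 0) - 1) :=
    Finset.sum_congr rfl fun i _ => by
      rcases (abs_eq zero_le_one).1 (hb i) with h | h <;> rw [h] <;> norm_num
  rw [groupProportion, hsum, Finset.sum_sub_distrib, ← Finset.mul_sum, Finset.sum_boole]
  simp only [hiff, Finset.sum_const, Finset.card_univ, Fintype.card_fin, nsmul_eq_mul]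
  field_simp

/-- In the good regime the conclusion holds, once `L` absorbs the constants. -/
lemma DataModel.learnsSpurious_of_regime (D : DataModel d) {N J : ℕ} {η σ0 L : ℝ}
    (ω : (Fin N → Seed d) × (Fin J → Patch d)) (hy : ∀ i, |(ω.1 i).1| = 1)
    (hb : ∀ i, |(ω.1 i).2.1| = 1) {κ θ ρ S low0 low m0 τ τ' ν n0 : ℝ}
    (R : (D.dynamics η ω hy hb).Regime κ θ ρ S low0 low m0 τ τ' ν n0) (hτ' : 0 ≤ τ')
    (hν : 0 ≤ ν) (hσ0 : 0 < σ0) (hL8 : 8 ≤ L) (hLκ : 4 ≤ κ * L) (hLθ : 1 ≤ L * D.βs * θ)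
    (hLS : 8 * S ≤ L * σ0) (hLm : 8 * σ0 ≤ L * (κ * m0)) :
    D.LearnsSpurious η σ0 L ω := by
  obtain ⟨T, hT1, hT2, hg, ⟨j0, hj0⟩, hc⟩ := R.exists_time hτ' hν
  have hN' : (0 : ℝ) < N := by exact_mod_cast R.N_pos
  have hη : 0 < η := R.η_pos
  have hβs : 0 < D.βs := D.βs_pos
  have hβc : 0 < D.βc := D.βc_pos
  have hκ := R.κ_pos
  have hS := R.S_pos
  have hm0 := R.m0_pos
  have hL : 0 < L := by linarith
  have hmean := D.two_mul_groupProportion_sub_one R.N_pos ω.1 hy hb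
  have hmean_ge : κ / 2 ≤ 2 * groupProportion (D.dataset ω.1) - 1 := by
    rw [hmean, le_div_iff₀ hN']
    exact R.sum_b
  have hmean_le : 2 * groupProportion (D.dataset ω.1) - 1 ≤ 1 := by
    rw [hmean, div_le_one hN']
    calc ∑ i, (ω.1 i).2.1 ≤ ∑ _i : Fin N, (1 : ℝ) :=
          Finset.sum_le_sum fun i _ => (le_abs_self _).trans (hb i).le
      _ = N := by simp
  set αhat := groupProportion (D.dataset ω.1)
  have hLi : L⁻¹ ≤ κ / 4 := by
    rw [inv_le_iff_one_le_mul₀ hL]; linarith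
  have hLi8 : L⁻¹ ≤ 1 / 8 := by
    rw [inv_le_iff_one_le_mul₀ hL]; linarith
  have hLi0 : 0 < L⁻¹ := inv_pos.2 hL
  change 1 / (8 * η * D.βs ^ 3 * S) ≤ T at hT1
  change η * T ≤ 8 / (κ * D.βs ^ 3 * m0) at hT2
  change θ ≤ inner ℝ (D.neuron η ω T j0) D.vs at hj0
  change ∀ j, |inner ℝ (D.neuron η ω T j) D.vc| ≤ 2 * S at hc
  refine ⟨by linarith, T, ?_, ?_, ?_, ?_, ?_⟩
  · refine le_trans ?_ hT1
    rw [inv_mul_eq_div, div_div, one_div_le_one_div (by positivity) (by positivity)]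
    have := mul_le_mul_of_nonneg_left hLS (by positivity : 0 ≤ η * D.βs ^ 3)
    linarith
  · rw [mul_one_div, le_div_iff₀ (by positivity)]
    rw [le_div_iff₀ (by positivity)] at hT2
    have h1 : 8 * σ0 * (T * (η * D.βs ^ 3)) ≤ L * (κ * m0) * (T * (η * D.βs ^ 3)) :=
      mul_le_mul_of_nonneg_right hLm (by positivity)
    have h2 : L * (η * T * (κ * D.βs ^ 3 * m0)) ≤ L * 8 := mul_le_mul_of_nonneg_left hT2 hL.le
    linarith
  · intro j t ht
    obtain ⟨g1, g2, g3, g4⟩ := hg t ht j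
    change κ / 4 * η * D.βs ^ 3 * inner ℝ (D.neuron η ω t j) D.vs ^ 2 ≤
      inner ℝ (D.neuron η ω (t + 1) j) D.vs - inner ℝ (D.neuron η ω t j) D.vs at g1
    change inner ℝ (D.neuron η ω (t + 1) j) D.vs - inner ℝ (D.neuron η ω t j) D.vs ≤
      4 * η * D.βs ^ 3 * inner ℝ (D.neuron η ω t j) D.vs ^ 2 at g2
    change 1 / 2 * η * D.βc ^ 3 * inner ℝ (D.neuron η ω t j) D.vc ^ 2 ≤
      inner ℝ (D.neuron η ω (t + 1) j) D.vc - inner ℝ (D.neuron η ω t j) D.vc at g3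
    change inner ℝ (D.neuron η ω (t + 1) j) D.vc - inner ℝ (D.neuron η ω t j) D.vc ≤
      4 * η * D.βc ^ 3 * inner ℝ (D.neuron η ω t j) D.vc ^ 2 at g4
    intro s s' c c' αh
    have hs0 : 0 ≤ η * D.βs ^ 3 * s ^ 2 := by positivity
    have hc0 : 0 ≤ η * D.βc ^ 3 * c ^ 2 := by positivity
    have ha : αh = αhat := rfl
    refine ⟨le_trans ?_ g1, g2.trans ?_, le_trans ?_ g3, g4.trans ?_⟩
    · have h1 : L⁻¹ * (2 * αh - 1) ≤ κ / 4 := by rw [ha]; nlinarith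
      have := mul_le_mul_of_nonneg_right h1 hs0
      linarith
    · have h1 : 4 ≤ L * αh := by rw [ha]; nlinarith
      have := mul_le_mul_of_nonneg_right h1 hs0
      linarith
    · have h1 : L⁻¹ * αh ≤ 1 / 2 := by rw [ha]; nlinarith
      have := mul_le_mul_of_nonneg_right h1 hc0
      linarith
    · have h1 : 4 ≤ L := by linarith
      have := mul_le_mul_of_nonneg_right h1 hc0
      linarith
  · refine le_trans (le_trans ?_ hj0) (le_ciSup (f := fun j => inner ℝ (D.neuron η ω T j) D.vs)
      (Set.finite_range _).bddAbove j0)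
    rw [inv_mul_eq_div, div_div, div_le_iff₀ (by positivity)]
    linarith
  · have : Nonempty (Fin J) := ⟨j0⟩
    have hbdd := (Set.finite_range fun j => inner ℝ (D.neuron η ω T j) D.vc).bddAbove
    have h2S : 2 * S ≤ L * σ0 := by linarith
    rw [abs_le]
    constructor
    · refine le_trans ?_ (le_ciSup hbdd j0)
      linarith [(abs_le.1 (hc j0)).1]
    · exact ciSup_le fun j => by linarith [(abs_le.1 (hc j)).2]

/-- The relations between the scales of the problem that hold for large `d`. Here `a` stands for
`log d`, `κ` for the majority margin and `M` for `√(log J)`, the typical size of the largest of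
`J` standard Gaussians. -/
structure DataModel.Scales (D : DataModel d) (K N J : ℕ) (κ σp σ0 a M : ℝ) : Prop where
  κ_pos : 0 < κ
  κ_le : κ ≤ 1
  σp_pos : 0 < σp
  σ0_pos : 0 < σ0
  a_ge : 2000 ≤ κ * a
  σp_le : σp ≤ a
  M_ge : 1 ≤ M
  M_le : M ≤ a
  d_pos : 0 < d
  pow_le : a ^ (7 * K + 15) ≤ √d
  pow_le_βc : a ^ (7 * K + 15) ≤ D.βc ^ 3 * √d
  σ0_le : σ0 * √d ≤ a ^ K
  σ0_ge : 1 ≤ a ^ K * (σ0 * √d)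
  J_le : J ≤ a ^ K
  N_ge : a ^ (3 * K + 13) ≤ N
  βs_ge : 1 ≤ a ^ K * D.βs
  βs_le : D.βs ≤ a ^ K
  βc_le : D.βc ≤ D.βs
  βc_le' : 256 * D.βc ^ 3 ≤ κ * D.βs ^ 3

set_option maxHeartbeats 1000000 in
/-- For a good draw the feature dynamics is in the good regime. The level `θ` has a power of
`log d` to spare over `1 / βs` so that the `J` neurons together keep the margins small. -/
lemma DataModel.GoodDraw.regime {D : DataModel d} {K N J : ℕ} {κ σp σ0 a M η : ℝ}
    (H : D.Scales K N J κ σp σ0 a M) (hη : 0 < η) (hη1 : η ≤ 1)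
    {ω : (Fin N → Seed d) × (Fin J → Patch d)}
    (G : D.GoodDraw κ σp σ0 a (2 * M) (a ^ (K + 1))⁻¹ (M / 2) ω) :
    (D.dynamics η ω G.label G.sign).Regime κ (a ^ (2 * K + 1) * D.βs)⁻¹ (σ0 * a ^ 4)
      (2 * M * σ0) (σ0 * (a ^ (K + 1))⁻¹) (σ0 * (a ^ (K + 2))⁻¹) (σ0 * (M / 2))
      (a * (σp / √d)) (a * (σp / √d) * (a * σp)) ((a * σp) ^ 2) (a * σ0 * (a * σp)) := by
  have hκ := H.κ_pos
  have hκ1 := H.κ_le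
  have hσp := H.σp_pos
  have hσ0 := H.σ0_pos
  have hM := H.M_ge
  have hM0 : 0 < M := by linarith
  have hMa := H.M_le
  have ha0 : 0 < a := by linarith
  have ha : 2000 ≤ a := by nlinarith [H.a_ge]
  have ha1 : 1 ≤ a := by linarith
  have hβs := D.βs_pos
  have hβc := D.βc_pos
  have hd : (0 : ℝ) < √d := Real.sqrt_pos.2 (by exact_mod_cast H.d_pos)
  have hN1 : (0 : ℝ) < N := lt_of_lt_of_le (by positivity) H.N_ge
  have hmono : ∀ {m n : ℕ}, m ≤ n → a ^ m ≤ a ^ n := fun h => pow_le_pow_right₀ ha1 h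
  obtain ⟨q, hq⟩ : ∃ q, q = 1 / √d := ⟨_, rfl⟩
  have hq0 : 0 < q := by rw [hq]; positivity
  have hqd : q * √d = 1 := by rw [hq]; field_simp
  have hdiv : σp / √d = σp * q := by rw [hq]; ring
  -- powers of `log d` against `1 / √d`
  have pq : ∀ n ≤ 7 * K + 15, a ^ n * q ≤ 1 := fun n hn => by
    have h := mul_le_mul_of_nonneg_right ((hmono hn).trans H.pow_le) hq0.le
    linarith
  have pc : ∀ n ≤ 7 * K + 15, a ^ n * q ≤ D.βc ^ 3 := fun n hn => by
    have h := mul_le_mul_of_nonneg_right ((hmono hn).trans H.pow_le_βc) hq0.le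
    nlinarith [pow_pos hβc 3]
  have hσq : σ0 ≤ a ^ K * q := by
    have h := mul_le_mul_of_nonneg_right H.σ0_le hq0.le
    nlinarith
  have hqσ : q ≤ a ^ K * σ0 := by
    have h := mul_le_mul_of_nonneg_right H.σ0_ge hq0.le
    nlinarith [pow_pos ha0 K]
  have hβ1 : ∀ p : ℕ, 1 ≤ a ^ (p * K) * D.βs ^ p := fun p => by
    have h := one_le_pow₀ (n := p) H.βs_ge
    rwa [mul_pow, ← pow_mul, mul_comm K p] at h
  have hβ2 : ∀ p : ℕ, D.βs ^ p ≤ a ^ (p * K) := fun p => by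
    have h := pow_le_pow_left₀ hβs.le H.βs_le p
    rwa [← pow_mul, mul_comm K p] at h
  obtain ⟨θ, hθ⟩ : ∃ θ, θ = (a ^ (2 * K + 1) * D.βs)⁻¹ := ⟨_, rfl⟩
  have hθ0 : 0 < θ := by rw [hθ]; positivity
  have hθβ : D.βs * θ = (a ^ (2 * K + 1))⁻¹ := by rw [hθ]; field_simp
  have hSq : M * σ0 ≤ a ^ (K + 1) * q := by
    calc M * σ0 ≤ a * (a ^ K * q) := mul_le_mul hMa hσq hσ0.le ha0.le
      _ = _ := by ring
  have hθle : θ ≤ (a ^ (K + 1))⁻¹ := by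
    rw [hθ]
    apply inv_anti₀ (by positivity)
    have := mul_le_mul_of_nonneg_left H.βs_ge (by positivity : 0 ≤ a ^ (K + 1))
    calc a ^ (K + 1) ≤ a ^ (K + 1) * (a ^ K * D.βs) := by linarith
      _ = _ := by ring
  rw [hdiv, ← hθ]
  refine
    { N_pos := by exact_mod_cast hN1
      η_pos := hη
      η_le := hη1
      βc_pos := hβc
      βs_pos := hβs
      βc_le := H.βc_le
      y_sign := G.label
      b_sign := G.sign
      κ_pos := hκ
      κ_le := hκ1
      sum_b := G.majority
      us_le := fun i => by rw [← hdiv]; exact G.noise_vs i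
      uc_le := fun i => by rw [← hdiv]; exact G.noise_vc i
      g_le := fun i k hik => by
        rw [← hdiv]
        exact (G.noise_pair i k hik).trans
          (mul_le_mul_of_nonneg_left (G.noise_norm k) (by positivity))
      g_diag := fun i => by
        change |inner ℝ (ω.1 i).2.2.2 (ω.1 i).2.2.2| ≤ _
        rw [real_inner_self_eq_norm_sq, abs_of_nonneg (by positivity)]
        exact pow_le_pow_left₀ (norm_nonneg _) (G.noise_norm i) 2
      τ_nonneg := by positivity
      s_le := G.init_vs_le
      c_le := G.init_vc_le
      s_ge := G.init_vs_ge
      c_ge := G.init_vc_ge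
      n_le := fun j i => (G.init_noise j i).trans
        (mul_le_mul_of_nonneg_left (G.noise_norm i) (by positivity))
      low0_pos := by positivity
      low_pos := by positivity
      m0_pos := by positivity
      S_pos := by positivity
      exists_large := G.init_max
      low_le := ?_
      separation := ?_
      θ_le := ?_
      S_lt := ?_
      S_small := ?_
      margin_small := ?_
      noise_s := ?_
      noise_c := ?_
      noise_n := ?_ }
  · have e1 : ∀ n : ℕ, 1 / (σ0 * (a ^ n)⁻¹) = a ^ n / σ0 := fun n => by field_simp
    have e2 : 64 / (κ * (σ0 * (M / 2))) ≤ a / σ0 := by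
      rw [div_le_div_iff₀ (by positivity) hσ0]
      have h1 : 64 ≤ κ * a * (M / 2) := by nlinarith [H.a_ge]
      have := mul_le_mul_of_nonneg_right h1 hσ0.le
      linarith
    rw [e1, e1]
    refine (add_le_add_right e2 _).trans ?_
    rw [← add_div]
    apply div_le_div_of_nonneg_right _ hσ0.le
    have h1 : a ≤ a ^ (K + 1) := by simpa using hmono (show 1 ≤ K + 1 by omega)
    have h2 : a ^ (K + 2) = a * a ^ (K + 1) := by ring
    nlinarith
  · change 64 * D.βc ^ 3 * (2 * M * σ0) ≤ κ * D.βs ^ 3 * (σ0 * (M / 2))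
    have := mul_le_mul_of_nonneg_right H.βc_le' (by positivity : 0 ≤ M * σ0 / 2)
    linarith
  · change D.βs ^ 3 * θ ≤ 1
    calc D.βs ^ 3 * θ = D.βs ^ 2 * (D.βs * θ) := by ring
      _ ≤ a ^ (2 * K) * (a ^ (2 * K + 1))⁻¹ := by
        rw [hθβ]; exact mul_le_mul_of_nonneg_right (hβ2 2) (by positivity)
      _ ≤ 1 := by
        rw [← div_eq_mul_inv, div_le_one (by positivity)]
        exact hmono (by omega)
  · rw [hθ, inv_eq_one_div, lt_div_iff₀ (by positivity)]
    calc 2 * (2 * M * σ0) * (a ^ (2 * K + 1) * D.βs)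
        = 4 * (a ^ (2 * K + 1) * (M * σ0) * D.βs) := by ring
      _ ≤ 4 * (a ^ (2 * K + 1) * (a ^ (K + 1) * q) * a ^ K) := by
        gcongr
        exact H.βs_le
      _ = 4 * (a ^ (4 * K + 2) * q) := by ring
      _ < 1 := by
        have h := pq (4 * K + 3) (by omega)
        have e : a ^ (4 * K + 3) * q = a * (a ^ (4 * K + 2) * q) := by ring
        have : 0 < a ^ (4 * K + 2) * q := by positivity
        nlinarith
  · change 8 * D.βs ^ 3 * (2 * M * σ0) ≤ 1
    calc 8 * D.βs ^ 3 * (2 * M * σ0) = 16 * (D.βs ^ 3 * (M * σ0)) := by ring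
      _ ≤ 16 * (a ^ (3 * K) * (a ^ (K + 1) * q)) := by
        gcongr
        exact hβ2 3
      _ = 16 * (a ^ (4 * K + 1) * q) := by ring
      _ ≤ 1 := by
        have h := pq (4 * K + 2) (by omega)
        have e : a ^ (4 * K + 2) * q = a * (a ^ (4 * K + 1) * q) := by ring
        have : 0 < a ^ (4 * K + 1) * q := by positivity
        nlinarith
  · change (J : ℝ) * (D.βs ^ 3 * θ ^ 3 + 8 * D.βc ^ 3 * (2 * M * σ0) ^ 3 + (σ0 * a ^ 4) ^ 3)
      ≤ κ / 8
    -- a cube of a number in `[0, 1]` is at most the number itself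
    have cube : ∀ {x B : ℝ}, 0 ≤ x → x ≤ B → B ≤ 1 → x ^ 3 ≤ B := fun {x B} h0 h1 h2 =>
      (pow_le_of_le_one h0 (h1.trans h2) three_ne_zero).trans h1
    have small : ∀ n ≤ 7 * K + 14, 2000 * (a ^ n * q) ≤ κ := fun n hn => by
      have h := pq (n + 1) (by omega)
      have e : a ^ (n + 1) * q = a * (a ^ n * q) := by ring
      have h1 := mul_le_mul_of_nonneg_right H.a_ge (by positivity : 0 ≤ a ^ n * q)
      have h2 := mul_le_mul_of_nonneg_left h hκ.le
      nlinarith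
    have t1 : J * (D.βs ^ 3 * θ ^ 3) ≤ κ / 24 := by
      have h1 : (D.βs * θ) ^ 3 ≤ (a ^ (2 * K + 1))⁻¹ :=
        cube (by positivity) hθβ.le (inv_le_one_of_one_le₀ (one_le_pow₀ ha1))
      calc J * (D.βs ^ 3 * θ ^ 3) = J * (D.βs * θ) ^ 3 := by ring
        _ ≤ a ^ K * (a ^ (2 * K + 1))⁻¹ := mul_le_mul H.J_le h1 (by positivity) (by positivity)
        _ ≤ κ / 24 := by
          rw [← div_eq_mul_inv, div_le_iff₀ (by positivity)]
          have h2 : a ^ (2 * K + 1) = a * a ^ (2 * K) := by ring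
          have h3 := hmono (show K ≤ 2 * K by omega)
          rw [h2]
          nlinarith [H.a_ge, pow_pos ha0 (2 * K)]
    have t2 : J * (8 * D.βc ^ 3 * (2 * M * σ0) ^ 3) ≤ κ / 24 := by
      have h0 : D.βc * (M * σ0) ≤ a ^ (2 * K + 1) * q := by
        calc D.βc * (M * σ0) ≤ a ^ K * (a ^ (K + 1) * q) :=
              mul_le_mul (H.βc_le.trans H.βs_le) hSq (by positivity) (by positivity)
          _ = _ := by ring
      have h1 : (D.βc * (M * σ0)) ^ 3 ≤ a ^ (2 * K + 1) * q :=
        cube (by positivity) h0 (pq _ (by omega))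
      calc J * (8 * D.βc ^ 3 * (2 * M * σ0) ^ 3) = 64 * (J * (D.βc * (M * σ0)) ^ 3) := by ring
        _ ≤ 64 * (a ^ K * (a ^ (2 * K + 1) * q)) := by
          gcongr
          exact H.J_le
        _ = 64 * (a ^ (3 * K + 1) * q) := by ring
        _ ≤ κ / 24 := by linarith [small (3 * K + 1) (by omega)]
    have t3 : J * (σ0 * a ^ 4) ^ 3 ≤ κ / 24 := by
      have h0 : σ0 * a ^ 4 ≤ a ^ (K + 4) * q := by
        calc σ0 * a ^ 4 ≤ a ^ K * q * a ^ 4 := mul_le_mul_of_nonneg_right hσq (by positivity)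
          _ = _ := by ring
      calc J * (σ0 * a ^ 4) ^ 3 ≤ a ^ K * (a ^ (K + 4) * q) :=
            mul_le_mul H.J_le (cube (by positivity) h0 (pq _ (by omega))) (by positivity)
              (by positivity)
        _ = a ^ (2 * K + 4) * q := by ring
        _ ≤ κ / 24 := by linarith [small (2 * K + 4) (by omega)]
    linarith
  · change 3 * (σ0 * a ^ 4) ^ 2 * (a * (σp * q)) ≤ κ / 8 * D.βs ^ 3 * (σ0 * (a ^ (K + 2))⁻¹) ^ 2
    have h1 : 3 * a ^ (2 * K + 13) * σp * q ≤ κ / 8 * D.βs ^ 3 := by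
      calc 3 * a ^ (2 * K + 13) * σp * q ≤ 3 * a ^ (2 * K + 13) * a * q := by
            gcongr
            exact H.σp_le
        _ = 3 * (a ^ (2 * K + 14) * q) * 1 := by ring
        _ ≤ 3 * (a ^ (2 * K + 14) * q) * (a ^ (3 * K) * D.βs ^ 3) :=
          mul_le_mul_of_nonneg_left (hβ1 3) (by positivity)
        _ = 3 * (a ^ (5 * K + 14) * q) * D.βs ^ 3 := by ring
        _ ≤ κ / 8 * D.βs ^ 3 := by
          apply mul_le_mul_of_nonneg_right _ (by positivity)
          have h := mul_le_mul_of_nonneg_left (pq (5 * K + 15) (by omega)) hκ.le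
          have e : a ^ (5 * K + 15) * q = a * (a ^ (5 * K + 14) * q) := by ring
          have h1 := mul_le_mul_of_nonneg_right H.a_ge
            (by positivity : 0 ≤ a ^ (5 * K + 14) * q)
          nlinarith
    have h2 := mul_le_mul_of_nonneg_right h1
      (by positivity : 0 ≤ (σ0 * (a ^ (K + 2))⁻¹) ^ 2)
    refine le_trans (le_of_eq ?_) h2
    field_simp
    ring
  · change 3 * (σ0 * a ^ 4) ^ 2 * (a * (σp * q)) ≤ 1 / 4 * D.βc ^ 3 * (σ0 * (a ^ (K + 2))⁻¹) ^ 2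
    have h1 : 3 * a ^ (2 * K + 13) * σp * q ≤ 1 / 4 * D.βc ^ 3 := by
      calc 3 * a ^ (2 * K + 13) * σp * q ≤ 3 * a ^ (2 * K + 13) * a * q := by
            gcongr
            exact H.σp_le
        _ = 1 / 4 * (12 * (a ^ (2 * K + 14) * q)) := by ring
        _ ≤ 1 / 4 * (a * (a ^ (2 * K + 14) * q)) := by
          gcongr
          linarith
        _ = 1 / 4 * (a ^ (2 * K + 15) * q) := by ring
        _ ≤ 1 / 4 * D.βc ^ 3 := by linarith [pc (2 * K + 15) (by omega)]
    have h2 := mul_le_mul_of_nonneg_right h1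
      (by positivity : 0 ≤ (σ0 * (a ^ (K + 2))⁻¹) ^ 2)
    refine le_trans (le_of_eq ?_) h2
    field_simp
    ring
  · change a * σ0 * (a * σp) + 3 * (a * (σp * q)) * (8 * θ / κ + 6 * (2 * M * σ0))
      + 3 * (8 / (κ * D.βs ^ 3 * (σ0 * (M / 2)))) * ((σ0 * a ^ 4) ^ 2 *
        ((a * σp) ^ 2 / N + a * (σp * q) * (a * σp))) ≤ σ0 * a ^ 4
    have hσpa := H.σp_le
    have hκa : 48 / κ ≤ a := by
      rw [div_le_iff₀ hκ]; linarith [H.a_ge]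
    have t0 : a * σ0 * (a * σp) ≤ σ0 * a ^ 3 := by
      calc a * σ0 * (a * σp) ≤ a * σ0 * (a * a) := by gcongr
        _ = _ := by ring
    have t1 : 3 * (a * (σp * q)) * (8 * θ / κ) ≤ σ0 * a ^ 2 := by
      calc 3 * (a * (σp * q)) * (8 * θ / κ)
          ≤ 3 * (a * (a * (a ^ K * σ0))) * (8 * (a ^ (K + 1))⁻¹ / κ) := by gcongr
        _ = 48 / κ * (σ0 * a / 2) := by field_simp; ring
        _ ≤ a * (σ0 * a / 2) := by gcongr
        _ ≤ σ0 * a ^ 2 := by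
          have : 0 ≤ σ0 * a ^ 2 := by positivity
          linarith
    have t2 : 3 * (a * (σp * q)) * (6 * (2 * M * σ0)) ≤ σ0 := by
      calc 3 * (a * (σp * q)) * (6 * (2 * M * σ0))
          ≤ 3 * (a * (a * q)) * (6 * (2 * a * σ0)) := by gcongr
        _ = 36 * (a ^ 3 * q) * σ0 := by ring
        _ ≤ a * (a ^ 3 * q) * σ0 := by
          gcongr
          linarith
        _ = (a ^ 4 * q) * σ0 := by ring
        _ ≤ 1 * σ0 := mul_le_mul_of_nonneg_right (pq 4 (by omega)) hσ0.le
        _ = σ0 := one_mul _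
    have t3 : 3 * (8 / (κ * D.βs ^ 3 * (σ0 * (M / 2)))) * ((σ0 * a ^ 4) ^ 2 *
        ((a * σp) ^ 2 / N + a * (σp * q) * (a * σp))) ≤ 2 * σ0 := by
      have hβi : 1 / D.βs ^ 3 ≤ a ^ (3 * K) := by
        rw [div_le_iff₀ (by positivity)]; exact hβ1 3
      have hMi : 1 / M ≤ 1 := by rw [div_le_one hM0]; exact hM
      have hNi : a ^ (3 * K + 13) * (1 / N + q) ≤ 2 := by
        have h1 : a ^ (3 * K + 13) * (1 / N) ≤ 1 := by
          rw [mul_one_div, div_le_one hN1]; exact H.N_ge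
        linarith [pq (3 * K + 13) (by omega)]
      calc 3 * (8 / (κ * D.βs ^ 3 * (σ0 * (M / 2)))) * ((σ0 * a ^ 4) ^ 2 *
            ((a * σp) ^ 2 / N + a * (σp * q) * (a * σp)))
          = 48 / κ * (1 / D.βs ^ 3) * (1 / M) * (σ0 * a ^ 10) * σp ^ 2 * (1 / N + q) := by
            field_simp
            ring
        _ ≤ a * a ^ (3 * K) * 1 * (σ0 * a ^ 10) * a ^ 2 * (1 / N + q) := by gcongr
        _ = a ^ (3 * K + 13) * (1 / N + q) * σ0 := by ring
        _ ≤ 2 * σ0 := mul_le_mul_of_nonneg_right hNi hσ0.le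
    have h5 : a ^ 3 + a ^ 2 + 3 ≤ a ^ 4 := by
      have h1 : a ^ 2 ≤ a ^ 3 := hmono (by norm_num)
      have h2 : 1 ≤ a ^ 3 := one_le_pow₀ ha1
      have h3 : a ^ 4 = a * a ^ 3 := by ring
      nlinarith
    have h6 := mul_le_mul_of_nonneg_left h5 hσ0.le
    linarith

end

/-! ### Choice of scales -/

section

open Filter in
/-- Powers of `log d` are eventually dominated by any positive power of `d`. -/
lemma eventually_log_pow_le_rpow (A : ℕ) {s : ℝ} (hs : 0 < s) :
    ∀ᶠ d : ℕ in atTop, Real.log d ^ A ≤ (d : ℝ) ^ s := by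
  have h := (isLittleO_log_rpow_rpow_atTop (A : ℝ) hs).def one_pos
  have h' := tendsto_natCast_atTop_atTop (R := ℝ) |>.eventually h
  filter_upwards [h', eventually_ge_atTop 1] with d hd hd1
  have hd1' : (1 : ℝ) ≤ d := by exact_mod_cast hd1
  rw [one_mul, Real.rpow_natCast, Real.norm_of_nonneg (by have := Real.log_nonneg hd1'; positivity),
    Real.norm_of_nonneg (by positivity)] at hd
  exact hd

/-- The scales of the problem are separated as required once `d` is large. -/
lemma DataModel.scales_of_large {d : ℕ} (D : DataModel d) {K N J : ℕ} {κ σp σ0 γ : ℝ}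
    (hκ : 0 < κ) (hκ1 : κ ≤ 1) (hσp : 0 < σp) (hσ0 : 0 < σ0)
    (h2000 : 2000 / κ ≤ Real.log d) (hσpd : σp ≤ Real.log d) (hKd : (K : ℝ) ≤ Real.log d)
    (hpow : Real.log d ^ (7 * K + 15) ≤ (d : ℝ) ^ (1 / 2 : ℝ))
    (hpow' : Real.log d ^ (7 * K + 15) ≤ (d : ℝ) ^ (1 / 2 - 3 * γ))
    (hJ3 : 3 ≤ J) (hJ : (J : ℝ) ≤ Real.log d ^ K) (hN : Real.log d ^ (3 * K + 13) ≤ (N : ℝ))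
    (hβs : (Real.log d ^ K)⁻¹ ≤ D.βs) (hβs' : D.βs ≤ Real.log d ^ K)
    (hβc : (d : ℝ) ^ (-γ) ≤ D.βc) (hβc' : D.βc ≤ κ / 256 * D.βs)
    (hσ : (Real.log d ^ K)⁻¹ / d ≤ σ0 ^ 2) (hσ' : σ0 ^ 2 ≤ Real.log d ^ K / d) :
    D.Scales K N J κ σp σ0 (Real.log d) (√(Real.log J)) := by
  set a := Real.log d with ha_def
  have haκ : 2000 ≤ κ * a := by rw [div_le_iff₀ hκ] at h2000; linarith
  have ha : 1 ≤ a := by nlinarith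
  have ha0 : 0 < a := by linarith
  have hd0 : 0 < d := by
    rcases Nat.eq_zero_or_pos d with h | h
    · rw [ha_def, h] at ha0; simp at ha0
    · exact h
  have hd : (0 : ℝ) < d := by exact_mod_cast hd0
  have hsq : √(d : ℝ) ^ 2 = d := Real.sq_sqrt hd.le
  have hsq0 : 0 < √(d : ℝ) := Real.sqrt_pos.2 hd
  have haK : 1 ≤ a ^ K := one_le_pow₀ ha
  have hJ3' : (3 : ℝ) ≤ J := by exact_mod_cast hJ3
  have hlogJ : 1 ≤ Real.log J := by
    rw [Real.le_log_iff_exp_le (by linarith)]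
    linarith [Real.exp_one_lt_d9]
  have hlogJ' : Real.log J ≤ a ^ 2 := by
    calc Real.log J ≤ Real.log (a ^ K) := Real.log_le_log (by linarith) hJ
      _ = K * Real.log a := by rw [Real.log_pow]
      _ ≤ a * a := mul_le_mul hKd (by linarith [Real.log_le_sub_one_of_pos ha0])
        (Real.log_nonneg ha) ha0.le
      _ = a ^ 2 := by ring
  have hβspos := D.βs_pos
  have hβcpos := D.βc_pos
  exact
    { κ_pos := hκ
      κ_le := hκ1
      σp_pos := hσp
      σ0_pos := hσ0
      a_ge := haκ
      σp_le := hσpd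
      M_ge := Real.one_le_sqrt.2 hlogJ
      M_le := Real.sqrt_le_iff.2 ⟨ha0.le, hlogJ'⟩
      d_pos := hd0
      pow_le := by rwa [Real.sqrt_eq_rpow]
      pow_le_βc := by
        refine hpow'.trans ?_
        have h3 : ((d : ℝ) ^ (-γ)) ^ 3 ≤ D.βc ^ 3 :=
          pow_le_pow_left₀ (Real.rpow_nonneg hd.le _) hβc 3
        calc (d : ℝ) ^ (1 / 2 - 3 * γ) = ((d : ℝ) ^ (-γ)) ^ 3 * √d := by
              rw [← Real.rpow_natCast, ← Real.rpow_mul hd.le, Real.sqrt_eq_rpow,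
                ← Real.rpow_add hd]
              congr 1
              push_cast
              ring
          _ ≤ _ := mul_le_mul_of_nonneg_right h3 hsq0.le
      σ0_le := by
        rw [le_div_iff₀ hd] at hσ'
        refine le_of_sq_le_sq ?_ (by positivity)
        rw [mul_pow, hsq]
        nlinarith
      σ0_ge := by
        rw [div_le_iff₀ hd, inv_le_iff_one_le_mul₀ (by positivity)] at hσ
        refine le_of_sq_le_sq ?_ (by positivity)
        rw [mul_pow, mul_pow, hsq]
        nlinarith
      J_le := hJ
      N_ge := hN
      βs_ge := by rw [inv_le_iff_one_le_mul₀ (by positivity)] at hβs; linarith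
      βs_le := hβs'
      βc_le := by nlinarith
      βc_le' := by
        have h := pow_le_pow_left₀ hβcpos.le hβc' 3
        have h1 : (κ / 256) ^ 3 ≤ κ / 256 :=
          pow_le_of_le_one (by positivity) (by linarith) three_ne_zero
        have h2 := mul_le_mul_of_nonneg_right h1 (by positivity : 0 ≤ D.βs ^ 3)
        rw [mul_pow] at h
        linarith }

/-- The union bound for the failure of a good draw is small once `d` and `J` are large. -/
lemma failure_bound_le {d N J K : ℕ} {κ δ : ℝ} (hκ : 0 < κ) (hδ : 0 < δ)
    (h1 : 20 / (κ ^ 2 * δ) ≤ Real.log d) (h2 : 20 / δ ≤ Real.log d)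
    (h3 : 2 * (2 * (K : ℝ) + 2) ≤ Real.log d) (h4 : 60 / δ ≤ Real.log d)
    (ha : 2 ≤ Real.log d) (hJd : Real.log d ^ K ≤ (d : ℝ) ^ (1 / 2 : ℝ))
    (hJ1 : 64 ≤ J) (hJ2 : 20 / δ ≤ J) (hJ3 : (15 / δ) ^ 2 ≤ J)
    (hJ : (J : ℝ) ≤ Real.log d ^ K) (hN : Real.log d ^ (3 * K + 13) ≤ (N : ℝ))
    (hN' : (N : ℝ) ≤ (d : ℝ) ^ K) :
    4 / (κ ^ 2 * N) + N * (2 + d + N + J) * (2 * Real.exp (-Real.log d ^ 2 / 2))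
      + J * (4 * Real.exp (-(2 * √(Real.log J)) ^ 2 / 2))
      + J * (4 * (Real.log d ^ (K + 1))⁻¹)
      + Real.exp (-(J * (Real.exp (-(√(Real.log J) / 2 + 1) ^ 2 / 2) / 3))) ≤ δ := by
  set a := Real.log d with ha_def
  have ha0 : 0 < a := by linarith
  have ha1 : 1 ≤ a := by linarith
  have hd : (0 : ℝ) < d := by
    rcases Nat.eq_zero_or_pos d with h | h
    · rw [ha_def, h] at ha0; simp at ha0
    · exact_mod_cast h
  have hda : (d : ℝ) = Real.exp a := (Real.exp_log hd).symm
  have hd3 : 3 ≤ (d : ℝ) := by rw [hda]; linarith [Real.add_one_le_exp a]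
  have hJ64 : (64 : ℝ) ≤ J := by exact_mod_cast hJ1
  have hJ0 : (0 : ℝ) < J := by linarith
  rw [div_le_iff₀ hδ] at h2 h4 hJ2
  have t1 : 4 / (κ ^ 2 * N) ≤ δ / 5 := by
    have hNa : a ≤ N :=
      le_trans (by simpa using pow_le_pow_right₀ ha1 (show 1 ≤ 3 * K + 13 by omega)) hN
    rw [div_le_iff₀ (by positivity)] at h1
    have := mul_le_mul_of_nonneg_right hNa (by positivity : 0 ≤ κ ^ 2 * δ)
    rw [div_le_div_iff₀ (mul_pos (by positivity) (by linarith)) (by norm_num)]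
    linarith
  -- `d = e^a`, so the `d^(2K+1)` events are beaten by the tail `e^(-a² / 2)`
  have t2 : N * (2 + d + N + J) * (2 * Real.exp (-a ^ 2 / 2)) ≤ δ / 5 := by
    have hdK : 1 ≤ (d : ℝ) ^ K := one_le_pow₀ (by linarith)
    have hJd' : (J : ℝ) ≤ d := by
      refine (hJ.trans hJd).trans ?_
      calc (d : ℝ) ^ (1 / 2 : ℝ) ≤ (d : ℝ) ^ (1 : ℝ) :=
            Real.rpow_le_rpow_of_exponent_le (by linarith) (by norm_num)
        _ = d := Real.rpow_one _
    have hsum : 2 + (d : ℝ) + N + J ≤ 4 * (d * (d : ℝ) ^ K) := by nlinarith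
    have hexp : (d : ℝ) ^ (2 * K + 1) * Real.exp (-a ^ 2 / 2) ≤ Real.exp (-a) := by
      rw [hda, ← Real.exp_nat_mul, ← Real.exp_add, Real.exp_le_exp]
      push_cast
      nlinarith
    have hea : a * Real.exp (-a) ≤ 1 := by
      rw [Real.exp_neg, ← div_eq_mul_inv, div_le_one (Real.exp_pos a)]
      linarith [Real.add_one_le_exp a]
    calc N * (2 + d + N + J) * (2 * Real.exp (-a ^ 2 / 2))
        ≤ (d : ℝ) ^ K * (4 * (d * (d : ℝ) ^ K)) * (2 * Real.exp (-a ^ 2 / 2)) := by gcongr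
      _ = 8 * ((d : ℝ) ^ (2 * K + 1) * Real.exp (-a ^ 2 / 2)) := by ring
      _ ≤ 8 * Real.exp (-a) := by linarith
      _ ≤ δ / 5 := by nlinarith [Real.exp_pos (-a)]
  have t3 : J * (4 * Real.exp (-(2 * √(Real.log J)) ^ 2 / 2)) ≤ δ / 5 := by
    have hM2 : √(Real.log J) ^ 2 = Real.log J :=
      Real.sq_sqrt (Real.log_nonneg (by linarith))
    have e : Real.exp (-(2 * √(Real.log J)) ^ 2 / 2) = ((J : ℝ) ^ 2)⁻¹ := by
      rw [show -(2 * √(Real.log J)) ^ 2 / 2 = -(2 * Real.log J) by rw [mul_pow, hM2]; ring,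
        Real.exp_neg]
      congr 1
      rw [two_mul, Real.exp_add, Real.exp_log hJ0]
      ring
    rw [e, show (J : ℝ) * (4 * ((J : ℝ) ^ 2)⁻¹) = 4 / J by field_simp,
      div_le_div_iff₀ hJ0 (by norm_num)]
    linarith
  have t4 : J * (4 * (a ^ (K + 1))⁻¹) ≤ δ / 5 := by
    calc J * (4 * (a ^ (K + 1))⁻¹) ≤ a ^ K * (4 * (a ^ (K + 1))⁻¹) := by gcongr
      _ = 4 / a := by field_simp; ring
      _ ≤ δ / 5 := by rw [div_le_div_iff₀ ha0 (by norm_num)]; linarith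
  have t5 : Real.exp (-(J * (Real.exp (-(√(Real.log J) / 2 + 1) ^ 2 / 2) / 3))) ≤ δ / 5 := by
    have hlogJ : 4 ≤ Real.log J := by
      rw [Real.le_log_iff_exp_le hJ0]
      have h := pow_le_pow_left₀ (Real.exp_pos 1).le Real.exp_one_lt_d9.le 4
      rw [← Real.exp_nat_mul] at h
      norm_num at h
      linarith
    have hM2 : √(Real.log J) ^ 2 = Real.log J := Real.sq_sqrt (by linarith)
    have hM : 2 ≤ √(Real.log J) := Real.le_sqrt_of_sq_le (by linarith)
    have hsJ : √(J : ℝ) ^ 2 = J := Real.sq_sqrt hJ0.le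
    have hsJ0 : 0 < √(J : ℝ) := Real.sqrt_pos.2 hJ0
    -- the best of `J` neurons exceeds half the typical maximum, since `J` times the tail
    -- probability at that level is at least of order `√J`
    have h1 : (√(J : ℝ))⁻¹ ≤ Real.exp (-(√(Real.log J) / 2 + 1) ^ 2 / 2) := by
      calc (√(J : ℝ))⁻¹ = Real.exp (-(Real.log J / 2)) := by
            rw [Real.exp_neg, Real.sqrt_eq_rpow, Real.rpow_def_of_pos hJ0]
            congr 3
            ring
        _ ≤ _ := by
            rw [Real.exp_le_exp]
            nlinarith
    have h2 : √(J : ℝ) / 3 ≤ J * (Real.exp (-(√(Real.log J) / 2 + 1) ^ 2 / 2) / 3) := by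
      have h3 := mul_le_mul_of_nonneg_left h1 hJ0.le
      have e : (J : ℝ) * (√(J : ℝ))⁻¹ = √(J : ℝ) := by
        rw [← div_eq_mul_inv, div_eq_iff hsJ0.ne', ← pow_two, hsJ]
      linarith
    have h3 : 15 / δ ≤ √(J : ℝ) := Real.le_sqrt_of_sq_le hJ3
    rw [div_le_iff₀ hδ] at h3
    calc Real.exp (-(J * (Real.exp (-(√(Real.log J) / 2 + 1) ^ 2 / 2) / 3)))
        ≤ Real.exp (-(√(J : ℝ) / 3)) := Real.exp_le_exp.2 (by linarith)
      _ ≤ (√(J : ℝ) / 3)⁻¹ := by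
        rw [Real.exp_neg]
        exact inv_anti₀ (by positivity) (by linarith [Real.add_one_le_exp (√(J : ℝ) / 3)])
      _ ≤ δ / 5 := by
        rw [inv_div, div_le_div_iff₀ hsJ0 (by norm_num)]
        linarith
  linarith

/-- A good draw leads to the conclusion, with `L = (log d)^(2K+2)` absorbing all constants and
logarithms. -/
lemma DataModel.GoodDraw.learnsSpurious {d : ℕ} {D : DataModel d} {K N J : ℕ}
    {κ σp σ0 a M η : ℝ} (H : D.Scales K N J κ σp σ0 a M) (hη : 0 < η) (hη1 : η ≤ 1)
    {ω : (Fin N → Seed d) × (Fin J → Patch d)}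
    (G : D.GoodDraw κ σp σ0 a (2 * M) (a ^ (K + 1))⁻¹ (M / 2) ω) :
    D.LearnsSpurious η σ0 (a ^ (2 * K + 2)) ω := by
  have hκ := H.κ_pos
  have hκ1 := H.κ_le
  have hσp := H.σp_pos
  have hσ0 := H.σ0_pos
  have hM := H.M_ge
  have hMa := H.M_le
  have haκ := H.a_ge
  have ha0 : 0 < a := by linarith
  have ha : 2000 ≤ a := by nlinarith
  have ha1 : 1 ≤ a := by linarith
  have hβspos := D.βs_pos
  have hL : a ^ 2 ≤ a ^ (2 * K + 2) := pow_le_pow_right₀ ha1 (by omega)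
  have hκL : 2000 ≤ κ * a ^ (2 * K + 2) := by
    have := mul_le_mul_of_nonneg_left hL hκ.le
    nlinarith
  refine D.learnsSpurious_of_regime ω G.label G.sign (G.regime H hη hη1) (by positivity)
    (by positivity) hσ0 (by nlinarith) (by linarith) ?_ ?_ ?_
  · rw [← div_eq_mul_inv, one_le_div (by positivity)]
    exact mul_le_mul_of_nonneg_right (pow_le_pow_right₀ ha1 (by omega)) hβspos.le
  · rw [← mul_assoc]
    exact mul_le_mul_of_nonneg_right (by nlinarith) hσ0.le
  · have h1 : 8 ≤ a ^ (2 * K + 2) * (κ * (M / 2)) := by nlinarith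
    have := mul_le_mul_of_nonneg_right h1 hσ0.le
    linarith

end

end SpuriousCNN

open SpuriousCNN

theorem theorem1
    -- constants that do not depend on the dimension
    (α σp γ : ℝ) (K : ℕ)
    (hα : 1 / 2 < α) (hα1 : α ≤ 1) (hσp : 0 < σp) (hγ : γ < 1 / 6) :
    -- exponents of the hidden logarithmic factors and the constant in `βc ≪ βs`
    ∃ (k m : ℕ) (c : ℝ), 0 < c ∧
    -- with high probability: the failure probability tends to `0` as `d, J → ∞`
    ∀ δ : ℝ, 0 < δ → ∃ d₀ J₀ : ℕ, ∀ d N J : ℕ, d₀ ≤ d →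
      -- polylogarithmically many neurons, polynomially many data
      J₀ ≤ J → (J : ℝ) ≤ Real.log d ^ K →
      Real.log d ^ m ≤ (N : ℝ) → (N : ℝ) ≤ (d : ℝ) ^ K →
      ∀ (D : DataModel d) (η σ0 : ℝ),
        -- feature strengths
        (Real.log d ^ K)⁻¹ ≤ D.βs → D.βs ≤ Real.log d ^ K →
        (d : ℝ) ^ (-γ) ≤ D.βc → D.βc ≤ c * D.βs →
        -- learning rate, and initialization with `σ0² = polylog(d) / d`
        0 < η → η ≤ 1 → 0 < σ0 →
        (Real.log d ^ K)⁻¹ / d ≤ σ0 ^ 2 → σ0 ^ 2 ≤ Real.log d ^ K / d →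
        D.jointLaw α σp σ0 N J {ω | ¬ D.LearnsSpurious η σ0 (Real.log d ^ k) ω}
          ≤ ENNReal.ofReal δ := by
  have hκ : 0 < 2 * α - 1 := by linarith
  refine ⟨2 * K + 2, 3 * K + 13, (2 * α - 1) / 256, by linarith, fun δ hδ => ?_⟩
  have hlog : ∀ C : ℝ, ∀ᶠ d : ℕ in Filter.atTop, C ≤ Real.log d := fun C =>
    (Real.tendsto_log_atTop.comp tendsto_natCast_atTop_atTop).eventually_ge_atTop C
  -- the exponent `1/2 - 3γ` is positive because `γ < 1/6`
  have hev := (hlog (2000 / (2 * α - 1))).and <| (hlog σp).and <| (hlog K).and <|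
    (eventually_log_pow_le_rpow (7 * K + 15) (by norm_num : (0 : ℝ) < 1 / 2)).and <|
    (eventually_log_pow_le_rpow (7 * K + 15) (by linarith : (0 : ℝ) < 1 / 2 - 3 * γ)).and <|
    (eventually_log_pow_le_rpow K (by norm_num : (0 : ℝ) < 1 / 2)).and <|
    (hlog (20 / ((2 * α - 1) ^ 2 * δ))).and <| (hlog (20 / δ)).and <|
    (hlog (2 * (2 * (K : ℝ) + 2))).and <| (hlog (60 / δ)).and (hlog 2)
  obtain ⟨d₀, hd₀⟩ := Filter.eventually_atTop.1 hev
  obtain ⟨J₁, hJ₁⟩ := exists_nat_ge (20 / δ)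
  obtain ⟨J₂, hJ₂⟩ := exists_nat_ge ((15 / δ) ^ 2)
  refine ⟨d₀, max 64 (max J₁ J₂), fun d N J hd hJ₀ hJ hN hN' D η σ0 hβs hβs' hβc hβc' hη hη1 hσ0
    hσ hσ' => ?_⟩
  obtain ⟨e1, e2, e3, e4, e5, e6, e7, e8, e9, e10, e11⟩ := hd₀ d hd
  have hJ64 : 64 ≤ J := (le_max_left _ _).trans hJ₀
  have hJJ₁ : (J₁ : ℝ) ≤ J := by
    exact_mod_cast ((le_max_left _ _).trans (le_max_right _ _)).trans hJ₀
  have hJJ₂ : (J₂ : ℝ) ≤ J := by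
    exact_mod_cast ((le_max_right _ _).trans (le_max_right _ _)).trans hJ₀
  have H := D.scales_of_large hκ (by linarith) hσp hσ0 e1 e2 e3 e4 e5 (by omega) hJ hN hβs hβs'
    hβc hβc' hσ hσ'
  have ha0 : 0 < Real.log d := by linarith
  have hNpos : 0 < N := by
    have : (0 : ℝ) < N := lt_of_lt_of_le (by positivity) hN
    exact_mod_cast this
  refine le_trans (measure_mono fun ω hω (G : D.GoodDraw (2 * α - 1) σp σ0 (Real.log d)
      (2 * √(Real.log J)) (Real.log d ^ (K + 1))⁻¹ (√(Real.log J) / 2) ω) =>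
        hω (G.learnsSpurious H hη hη1))
    ((D.measure_not_goodDraw_le hα hα1 hσp hσ0 ha0.le (by positivity) (by positivity)
      (by positivity) hNpos).trans (ENNReal.ofReal_le_ofReal ?_))
  exact failure_bound_le hκ hδ e7 e8 e9 e10 e11 e6 hJ64 (hJ₁.trans hJJ₁) (hJ₂.trans hJJ₂)
    hJ hN hN'
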